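/- Let $k\ge 3$ be an integer, and for an integer $m\ge 2$ let $T_m:[0,1)\to[0,1)$, $T_m(x)=mx \bmod 1$. For real $a<b$ let $\mathcal W_m(a,b)=\{x\in[0,1): T_m^n x\notin(a,b)\text{ for all } n\ge 0\}$, and let $d_m(a,b)$ be the Hausdorff dimension of $\mathcal W_m(a,b)$. Let $g_k:[0,1]\to[0,1]$ be the generalized Cantor function: write $x=\sum_{n\ge1}a_nk^{-n}$ with $a_n\in\{0,\dots,k-1\}$ and put $$g_k(x)=\sum_{n=1}^{N-1}\frac{a_n}{(k-1)2^n}+\frac1{2^N}$$ if $N$ is the least index with $a_N\notin\{0,k-1\}$, and $g_k(x)=\sum_{n\ge1}\frac{a_n}{(k-1)2^n}$ if there is no such index (the value does not depend on the choice of the expansion). Let $\chi$ be the Glendinning–Sidorov function, defined as follows. For a rational $r=p/q\in(0,1)$ in lowest terms let $\rho_r$ be the substitution on $0$-$1$ words that sends $0$ to the word of length $q$ with letters $\lceil ir\rceil-\lceil (i-1)r\rceil$ and $1$ to the word with letters $\lfloor ir\rfloor-\lfloor (i-1)r\rfloor$, $0\le i<q$ (the largest word beginning with $0$ and the smallest word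 beginning with $1$ among the cyclically balanced words of length $q$ with $p$ ones). For a finite, possibly empty, list $\mathbf r=(r_1,\dots,r_n)$ of rationals in $(0,1)$ put $s_{\mathbf r}=\rho_{r_1}\cdots\rho_{r_n}(0)$ and $t_{\mathbf r}=\rho_{r_1}\cdots\rho_{r_n}(1)$. Reading infinite $0$-$1$ words as binary expansions of real numbers, and with $w^\infty=www\cdots$, put $$\chi(x)=\sup\{\,t_{\mathbf r}s_{\mathbf r}^\infty \;:\; s_{\mathbf r}^\infty\le x\,\}\qquad(x\ge 0).$$ Then for all $0\le a<\frac1k$ and $\frac{k-1}k<b\le 1$: $$d_k(a,b)=(\log_k 2)\; d_2(g_k(a),g_k(b)),$$ and $d_k(a,b)>0$ if and only if $g_k(b)<\chi(g_k(a))$. -/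

import Mathlib

namespace HoleDim

noncomputable section

/-- The expanding map `T_k x = k x mod 1`. -/
def expandingMap (k : ℕ) (x : ℝ) : ℝ := Int.fract ((k : ℝ) * x)

/-- The survivor set `W_k(a,b)` of `T_k` on `[0,1)` with hole `(a,b)`. -/
def survivorSet (k : ℕ) (a b : ℝ) : Set ℝ :=
  {x | x ∈ Set.Ico (0 : ℝ) 1 ∧ ∀ n : ℕ, (expandingMap k)^[n] x ∉ Set.Ioo a b}

/-- `d_k(a,b)`, the Hausdorff dimension of the survivor set. -/
def survivorDim (k : ℕ) (a b : ℝ) : ENNReal := dimH (survivorSet k a b)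

/-! ### The generalized Cantor function -/

/-- The digits of `x ∈ [0,1]` in base `k`: `x = ∑ n, digit k x n / k ^ (n + 1)`. For `x < 1` this is
the greedy expansion (the one that does not end in `k - 1` repeated); for `x = 1` every digit is
`k - 1`. -/
def digit (k : ℕ) (x : ℝ) (n : ℕ) : ℕ :=
  if x = 1 then k - 1 else ⌊x * (k : ℝ) ^ (n + 1)⌋₊ % k

open Classical in
/-- The generalized Cantor function `g_k` on `[0,1]`. Digits are numbered from `0` here, so the
first digit outside `{0, k-1}`, if there is one, is the one in position `Nat.find h + 1`. -/
def cantorFun (k : ℕ) (x : ℝ) : ℝ :=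
  if h : ∃ n, digit k x n ≠ 0 ∧ digit k x n ≠ k - 1 then
    (∑ n ∈ Finset.range (Nat.find h), (digit k x n : ℝ) / (((k : ℝ) - 1) * 2 ^ (n + 1)))
      + 1 / 2 ^ (Nat.find h + 1)
  else
    ∑' n : ℕ, (digit k x n : ℝ) / (((k : ℝ) - 1) * 2 ^ (n + 1))

/-! ### The Glendinning–Sidorov function -/

/-- For `r = p / q` in lowest terms, `0 < r < 1`, the cyclically balanced `0-1` words of length `q`
with `p` ones form one class under cyclic shifts. This is the largest word of the class that begins
with `0`. -/
def zeroMax (r : ℚ) : List ℕ :=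
  (List.range r.den).map fun i => (⌈(i : ℚ) * r⌉ - ⌈((i : ℚ) - 1) * r⌉).toNat

/-- The smallest cyclically balanced word of slope `r` that begins with `1`. -/
def oneMin (r : ℚ) : List ℕ :=
  (List.range r.den).map fun i => (⌊(i : ℚ) * r⌋ - ⌊((i : ℚ) - 1) * r⌋).toNat

/-- The substitution `ρ_r : 0 ↦ zeroMax r, 1 ↦ oneMin r`. -/
def balancedSubst (r : ℚ) (w : List ℕ) : List ℕ :=
  w.flatMap fun c => if c = 0 then zeroMax r else oneMin r

/-- `ρ_{r₁} (ρ_{r₂} (⋯ (ρ_{rₙ} (c))))` for `rs = [r₁, …, rₙ]` and a letter `c`. -/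
def iterSubst (rs : List ℚ) (c : ℕ) : List ℕ := rs.foldr balancedSubst [c]

/-- The real number with binary expansion `u v v v ⋯`. -/
def binaryValue (u v : List ℕ) : ℝ :=
  ∑' n : ℕ, ((if n < u.length then u.getD n 0
    else v.getD ((n - u.length) % v.length) 0 : ℕ) : ℝ) / 2 ^ (n + 1)

/-- The Glendinning–Sidorov function `χ`. Each finite (possibly empty) list `r₁, …, rₙ` of rationals
in `(0,1)`, with `s = ρ_{r₁} ⋯ ρ_{rₙ} (0)` and `t = ρ_{r₁} ⋯ ρ_{rₙ} (1)`, gives the plateau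
`[s s s ⋯, s t s s s ⋯]`, on which `χ` has the constant value `t s s s ⋯` (infinite words are read as
binary expansions). At the remaining points `χ` is the supremum of the heights of the plateaus to the
left. For the empty list the plateau is `[0, 1/4]` and its height is `1/2`. -/
def chi (a : ℝ) : ℝ :=
  sSup {y : ℝ | ∃ rs : List ℚ, (∀ r ∈ rs, 0 < r ∧ r < 1) ∧
    binaryValue (iterSubst rs 0) (iterSubst rs 0) ≤ a ∧
    y = binaryValue (iterSubst rs 1) (iterSubst rs 0)}

end

end HoleDim

/-!
Survivors of `T_k` have only the digits `0` and `k - 1`, so they are coded by `0`-`1` sequences, and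
for codings with infinitely many of both letters the condition to avoid `(a, b)` in base `k` is the
condition to avoid `(g_k(a), g_k(b))` in base `2` (`survivorCodes_cantorFun`). Two codings that first
differ in place `n` have tails on different sides of the hole there, so their values differ by about
`k⁻ⁿ` in base `k` and by about `2⁻ⁿ` in base `2`. The change of base is thus bi-Hölder, which gives
the formula for the dimension (`survivorDim_cantorFun`).

It remains to show, for `a < 1/2 < b`, that the survivor set of the doubling map has positive dimension
if and only if `b < χ(a)`. The substitutions `ρ_{r₁} ⋯ ρ_{rₙ}` with `n ≥ 1` are exactly the composites
of the elementary substitutions `0 ↦ 0, 1 ↦ 10`, and `0 ↦ 01, 1 ↦ 1`, and `0 ↦ 01, 1 ↦ 10` that end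
with the third (`exists_reach_of_slopes`, `Reach.exists_slopes`). This comes from the Euclidean
algorithm for the slopes. So `b < χ(a)` means that some composite `M = (0 ↦ s, 1 ↦ t)` has
`(st)^∞ ≤ a` and `b < ts(st)^∞` (`lt_chi_iff`).

If there is such an `M`, all sequences of the blocks `s(st)^n` and `s(st)^(n+1)` survive for large `n`
(`Reach.survivorDim_pos`). If there is none, the survivors can be renormalized forever: whenever they
are eventually images of admissible sequences under `M`, the positions of `(st)^∞` and `(ts)^∞`
relative to the hole forbid the blocks `011`, or the blocks `100`, or all that disagree with a product
of `01` and `10`, so that `M` can be composed with one of the elementary substitutions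
(`NoWitness.step`). The words `s` and `t` get longer, and the limit set of the two word maps then has
small similarity dimension, so the dimension of the survivor set is `0`
(`NoWitness.survivorDim_eq_zero`).
-/

open Set Filter Topology
open scoped ENNReal NNReal

namespace HoleDim

noncomputable section

/-! ### Words as affine maps and coded limit points -/

/-- Prepending the word `w` to a binary expansion, as a map on values: if `x` has the binary
expansion `x₁ x₂ ⋯`, then `wordMap w x` has the expansion `w x₁ x₂ ⋯`. -/
def wordMap (w : List ℕ) (x : ℝ) : ℝ := w.foldr (fun c z => ((c : ℝ) + z) / 2) x

@[simp] lemma wordMap_nil (x : ℝ) : wordMap [] x = x := rfl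

lemma wordMap_cons (c : ℕ) (w : List ℕ) (x : ℝ) :
    wordMap (c :: w) x = ((c : ℝ) + wordMap w x) / 2 := rfl

lemma wordMap_append (u v : List ℕ) (x : ℝ) : wordMap (u ++ v) x = wordMap u (wordMap v x) := by
  simp [wordMap, List.foldr_append]

lemma wordMap_eq (w : List ℕ) (x : ℝ) : wordMap w x = wordMap w 0 + (1 / 2) ^ w.length * x := by
  induction w with
  | nil => simp
  | cons c w ih => rw [wordMap_cons, wordMap_cons, ih, List.length_cons, pow_succ]; ring

lemma wordMap_strictMono (w : List ℕ) : StrictMono (wordMap w) := by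
  intro x y h
  rw [wordMap_eq w x, wordMap_eq w y]
  have : (0 : ℝ) < (1 / 2) ^ w.length := by positivity
  nlinarith

lemma wordMap_mono (w : List ℕ) : Monotone (wordMap w) := (wordMap_strictMono w).monotone

lemma wordMap_nonneg (w : List ℕ) {x : ℝ} (hx : 0 ≤ x) : 0 ≤ wordMap w x := by
  induction w with
  | nil => simpa
  | cons c w ih => rw [wordMap_cons]; positivity

lemma wordMap_le_one {w : List ℕ} (hw : ∀ c ∈ w, c ≤ 1) {x : ℝ} (hx : x ≤ 1) :
    wordMap w x ≤ 1 := by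
  induction w with
  | nil => simpa
  | cons c w ih =>
    rw [wordMap_cons]
    have h1 := ih fun d hd => hw d (List.mem_cons_of_mem _ hd)
    have h2 : (c : ℝ) ≤ 1 := by exact_mod_cast hw c List.mem_cons_self
    linarith

/-- A word map with a nonempty word is a contraction, so it has at most one fixed point. -/
lemma wordMap_fixed_unique {w : List ℕ} (hw : w ≠ []) {x y : ℝ} (hx : wordMap w x = x)
    (hy : wordMap w y = y) : x = y := by
  rw [wordMap_eq] at hx hy
  have h1 : ((1 : ℝ) / 2) ^ w.length < 1 :=
    pow_lt_one₀ (by norm_num) (by norm_num) (by simpa using hw)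
  have : (x - y) * (1 - (1 / 2) ^ w.length) = 0 := by linarith
  rcases mul_eq_zero.1 this with h | h <;> linarith

/-- Two increasing affine contractions `x ↦ c i + l i * x` of `[0,1]` into itself, indexed by the
letters `false` and `true`. -/
@[ext]
structure Ifs where
  /-- the translation parts -/
  c : Bool → ℝ
  /-- the contraction ratios -/
  l : Bool → ℝ
  c_nonneg : ∀ i, 0 ≤ c i
  l_pos : ∀ i, 0 < l i
  l_le : ∀ i, l i ≤ 1 / 2
  le_one : ∀ i, c i + l i ≤ 1

/-- The shift of a `0`-`1` sequence by `n` places. -/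
def shift (n : ℕ) (e : ℕ → Bool) : ℕ → Bool := fun i => e (i + n)

@[simp] lemma shift_zero (e : ℕ → Bool) : shift 0 e = e := rfl

@[simp] lemma shift_apply (n : ℕ) (e : ℕ → Bool) (i : ℕ) : shift n e i = e (i + n) := rfl

@[simp] lemma shift_shift (m n : ℕ) (e : ℕ → Bool) : shift m (shift n e) = shift (m + n) e := by
  funext i; simp [add_assoc]

namespace Ifs

variable (F : Ifs)

/-- The affine map with letter `i`. -/
def map (i : Bool) (x : ℝ) : ℝ := F.c i + F.l i * x

lemma map_strictMono (i : Bool) : StrictMono (F.map i) := by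
  intro x y h
  have := F.l_pos i
  simp only [map]; nlinarith

/-- The limit point of the nested images `F.map (e 0) (F.map (e 1) (⋯ [0,1]))`. -/
def code (e : ℕ → Bool) : ℝ := ∑' n, (∏ i ∈ Finset.range n, F.l (e i)) * F.c (e n)

lemma prod_nonneg (e : ℕ → Bool) (n : ℕ) : 0 ≤ ∏ i ∈ Finset.range n, F.l (e i) :=
  Finset.prod_nonneg fun _ _ => (F.l_pos _).le

lemma prod_le (e : ℕ → Bool) (n : ℕ) : ∏ i ∈ Finset.range n, F.l (e i) ≤ (1 / 2) ^ n := by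
  calc _ ≤ ∏ i ∈ Finset.range n, (1 / 2 : ℝ) :=
        Finset.prod_le_prod (fun _ _ => (F.l_pos _).le) fun _ _ => F.l_le _
    _ = _ := by simp

lemma summable_code (e : ℕ → Bool) :
    Summable fun n => (∏ i ∈ Finset.range n, F.l (e i)) * F.c (e n) := by
  refine Summable.of_nonneg_of_le (fun n => mul_nonneg (F.prod_nonneg e n) (F.c_nonneg _))
    (fun n => ?_) (summable_geometric_of_lt_one (r := (1 / 2 : ℝ)) (by norm_num) (by norm_num))
  have h1 : F.c (e n) ≤ 1 := by linarith [F.le_one (e n), F.l_pos (e n)]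
  calc _ ≤ (1 / 2 : ℝ) ^ n * 1 :=
        mul_le_mul (F.prod_le e n) h1 (F.c_nonneg _) (by positivity)
    _ = _ := by ring

lemma code_eq (e : ℕ → Bool) : F.code e = F.map (e 0) (F.code (shift 1 e)) := by
  rw [code, (F.summable_code e).tsum_eq_zero_add, map, code, ← tsum_mul_left]
  simp only [Finset.prod_range_zero, one_mul]
  congr 1
  refine tsum_congr fun n => ?_
  rw [Finset.prod_range_succ']
  simp only [shift_apply]; ring

lemma code_shift (e : ℕ → Bool) (n : ℕ) :
    F.code (shift n e) = F.map (e n) (F.code (shift (n + 1) e)) := by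
  rw [code_eq, shift_shift, add_comm 1 n]; simp

/-- The geometric bound below is `2` for a general sum of this type; self-similarity improves
it to `1`. -/
lemma code_mem (e : ℕ → Bool) : F.code e ∈ Icc (0 : ℝ) 1 := by
  have hnn : ∀ e, 0 ≤ F.code e := fun e =>
    tsum_nonneg fun n => mul_nonneg (F.prod_nonneg e n) (F.c_nonneg _)
  refine ⟨hnn e, ?_⟩
  have h2 : ∀ e, F.code e ≤ 2 := fun e => by
    rw [← tsum_geometric_two]
    refine (F.summable_code e).tsum_le_tsum (fun n => ?_)
      (summable_geometric_of_lt_one (by norm_num) (by norm_num))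
    have h1 : F.c (e n) ≤ 1 := by linarith [F.le_one (e n), F.l_pos (e n)]
    calc _ ≤ (1 / 2 : ℝ) ^ n * 1 :=
          mul_le_mul (F.prod_le e n) h1 (F.c_nonneg _) (by positivity)
      _ = _ := by ring
  have h3 : ∀ n e, F.code e ≤ 1 + (1 / 2) ^ n := by
    intro n
    induction n with
    | zero => intro e; have := h2 e; norm_num; linarith
    | succ n ih =>
      intro e
      rw [code_eq, map, pow_succ]
      have ha := F.l_pos (e 0)
      have hb := F.l_le (e 0)
      have hc := F.le_one (e 0)
      have hp : (0 : ℝ) < (1 / 2) ^ n := by positivity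
      nlinarith [ih (shift 1 e)]
  have h4 : Tendsto (fun n : ℕ => 1 + (1 / 2 : ℝ) ^ n) atTop (𝓝 (1 + 0)) :=
    tendsto_const_nhds.add (tendsto_pow_atTop_nhds_zero_of_lt_one (by norm_num) (by norm_num))
  simpa using ge_of_tendsto' h4 fun n => h3 n e

/-- A bounded backward orbit along `e` is the orbit of the coded point. -/
lemma code_unique {e : ℕ → Bool} {u : ℕ → ℝ} (hu : ∀ n, u n ∈ Icc (0 : ℝ) 1)
    (h : ∀ n, u n = F.map (e n) (u (n + 1))) (n : ℕ) : u n = F.code (shift n e) := by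
  have key : ∀ m n, |u n - F.code (shift n e)| ≤ (1 / 2) ^ m := by
    intro m
    induction m with
    | zero =>
      intro n
      have h1 := hu n
      have h2 := F.code_mem (shift n e)
      rw [pow_zero, abs_le]
      constructor <;> linarith [h1.1, h1.2, h2.1, h2.2]
    | succ m ih =>
      intro n
      rw [h n, code_shift]
      have : F.map (e n) (u (n + 1)) - F.map (e n) (F.code (shift (n + 1) e)) =
          F.l (e n) * (u (n + 1) - F.code (shift (n + 1) e)) := by simp only [map]; ring
      rw [this, abs_mul, abs_of_pos (F.l_pos _), pow_succ, mul_comm]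
      exact mul_le_mul (ih _) (F.l_le _) (F.l_pos _).le (by positivity)
  have h4 : Tendsto (fun n : ℕ => (1 / 2 : ℝ) ^ n) atTop (𝓝 0) :=
    tendsto_pow_atTop_nhds_zero_of_lt_one (by norm_num) (by norm_num)
  have h5 := ge_of_tendsto' h4 fun m => key m n
  exact sub_eq_zero.1 (abs_eq_zero.1 (le_antisymm h5 (abs_nonneg _)))

lemma code_sub {e e' : ℕ → Bool} (n : ℕ) (h : ∀ i < n, e i = e' i) :
    F.code e - F.code e' = (∏ i ∈ Finset.range n, F.l (e i)) *
      (F.code (shift n e) - F.code (shift n e')) := by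
  induction n with
  | zero => simp
  | succ n ih =>
    rw [ih fun i hi => h i (by omega), code_shift F e, code_shift F e', ← h n (by omega),
      Finset.prod_range_succ]
    simp only [map]; ring

end Ifs

/-! ### Hausdorff dimension of coded sets -/

/-- If the `F`-values of two codes that first differ in place `n` are at least of order `lam ^ n`
apart and their `H`-values at most of order `(lam ^ r) ^ n`, then `H ∘ F⁻¹` is Hölder with
exponent `r`. -/
lemma dimH_image_le_of_separated {S : Set (ℕ → Bool)} {F H : (ℕ → Bool) → ℝ} {δ lam r : ℝ}
    (hδ : 0 < δ) (hlam : 0 < lam) (hr : 0 < r)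
    (hF : ∀ e ∈ S, ∀ e' ∈ S, ∀ n, (∀ i < n, e i = e' i) → e n = false → e' n = true →
      δ * lam ^ n ≤ |F e - F e'|)
    (hH : ∀ e ∈ S, ∀ e' ∈ S, ∀ n, (∀ i < n, e i = e' i) → |H e - H e'| ≤ (lam ^ r) ^ n) :
    dimH (H '' S) ≤ dimH (F '' S) / ENNReal.ofReal r := by
  classical
  have main : ∀ e ∈ S, ∀ e' ∈ S, |H e - H e'| ≤ δ⁻¹ ^ r * |F e - F e'| ^ r := by
    intro e he e' he'
    by_cases h : e = e'
    · subst h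
      simp [Real.zero_rpow hr.ne']
    have hex : ∃ n, e n ≠ e' n := Function.ne_iff.1 h
    have hn := Nat.find_spec hex
    have hlt : ∀ i < Nat.find hex, e i = e' i := fun i hi => not_not.1 (Nat.find_min hex hi)
    have h1 : δ * lam ^ Nat.find hex ≤ |F e - F e'| := by
      rcases Bool.eq_false_or_eq_true (e (Nat.find hex)) with h0 | h0
      · have h0' : e' (Nat.find hex) = false := by
          cases h' : e' (Nat.find hex)
          · rfl
          · rw [h0, h'] at hn; exact absurd rfl hn
        rw [abs_sub_comm]
        exact hF e' he' e he _ (fun i hi => (hlt i hi).symm) h0' h0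
      · have h0' : e' (Nat.find hex) = true := by
          cases h' : e' (Nat.find hex)
          · rw [h0, h'] at hn; exact absurd rfl hn
          · rfl
        exact hF e he e' he' _ hlt h0 h0'
    calc |H e - H e'| ≤ (lam ^ r) ^ Nat.find hex := hH e he e' he' _ hlt
      _ = (lam ^ Nat.find hex) ^ r := by
          rw [← Real.rpow_natCast, ← Real.rpow_mul hlam.le, ← Real.rpow_natCast lam,
            ← Real.rpow_mul hlam.le, mul_comm]
      _ ≤ (δ⁻¹ * |F e - F e'|) ^ r := by
          refine Real.rpow_le_rpow (by positivity) ?_ hr.le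
          rw [inv_mul_eq_div, le_div_iff₀ hδ]; linarith
      _ = δ⁻¹ ^ r * |F e - F e'| ^ r := Real.mul_rpow (by positivity) (by positivity)
  have hinj : InjOn F S := by
    intro e he e' he' h
    by_contra hne
    have hex : ∃ n, e n ≠ e' n := Function.ne_iff.1 hne
    have hn := Nat.find_spec hex
    have hlt : ∀ i < Nat.find hex, e i = e' i := fun i hi => not_not.1 (Nat.find_min hex hi)
    have hpos : 0 < δ * lam ^ Nat.find hex := by positivity
    rcases Bool.eq_false_or_eq_true (e (Nat.find hex)) with h0 | h0 <;>
      rcases Bool.eq_false_or_eq_true (e' (Nat.find hex)) with h1 | h1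
    · exact hn (h0.trans h1.symm)
    · have := hF e' he' e he _ (fun i hi => (hlt i hi).symm) h1 h0
      rw [h, sub_self, abs_zero] at this; linarith
    · have := hF e he e' he' _ hlt h0 h1
      rw [h, sub_self, abs_zero] at this; linarith
    · exact hn (h0.trans h1.symm)
  have himg : H '' S = (H ∘ Function.invFunOn F S) '' (F '' S) := by
    rw [image_image]
    refine image_congr fun e he => ?_
    simp only [Function.comp]
    rw [hinj.leftInvOn_invFunOn he]
  have hold : HolderOnWith (Real.toNNReal (δ⁻¹ ^ r)) (Real.toNNReal r)
      (H ∘ Function.invFunOn F S) (F '' S) := by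
    rintro _ ⟨e, he, rfl⟩ _ ⟨e', he', rfl⟩
    simp only [Function.comp]
    rw [hinj.leftInvOn_invFunOn he, hinj.leftInvOn_invFunOn he', edist_dist, edist_dist,
      Real.dist_eq, Real.dist_eq, Real.coe_toNNReal _ hr.le,
      ENNReal.ofReal_rpow_of_nonneg (abs_nonneg _) hr.le]
    change _ ≤ ENNReal.ofReal _ * _
    rw [← ENNReal.ofReal_mul (by positivity)]
    exact ENNReal.ofReal_le_ofReal (main e he e' he')
  rw [himg]
  exact hold.dimH_image_le (Real.toNNReal_pos.2 hr)

lemma Ifs.abs_code_sub_le (F : Ifs) {e e' : ℕ → Bool} {n : ℕ} (h : ∀ i < n, e i = e' i) :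
    |F.code e - F.code e'| ≤ ∏ i ∈ Finset.range n, F.l (e i) := by
  rw [F.code_sub n h, abs_mul, abs_of_nonneg (F.prod_nonneg _ _)]
  have h1 := F.code_mem (shift n e)
  have h2 := F.code_mem (shift n e')
  have h3 : |F.code (shift n e) - F.code (shift n e')| ≤ 1 := by
    rw [abs_le]; constructor <;> linarith [h1.1, h1.2, h2.1, h2.2]
  calc _ ≤ (∏ i ∈ Finset.range n, F.l (e i)) * 1 :=
        mul_le_mul_of_nonneg_left h3 (F.prod_nonneg _ _)
    _ = _ := mul_one _

/-- The dimension of the limit set is at most the similarity dimension. -/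
lemma Ifs.dimH_range_code_le (F : Ifs) {d : ℝ≥0}
    (hd : F.l false ^ (d : ℝ) + F.l true ^ (d : ℝ) ≤ 1) : dimH (range F.code) ≤ d := by
  let t : ∀ n : ℕ, (Fin n → Bool) → Set ℝ := fun n w =>
    F.code '' {e | ∀ i : Fin n, e i = w i}
  have hdiam : ∀ n w, Metric.ediam (t n w) ≤ ENNReal.ofReal (∏ i, F.l (w i)) := by
    intro n w
    refine Metric.ediam_le ?_
    rintro _ ⟨e, he, rfl⟩ _ ⟨e', he', rfl⟩
    rw [edist_dist, Real.dist_eq]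
    refine ENNReal.ofReal_le_ofReal ?_
    have : ∏ i, F.l (w i) = ∏ i ∈ Finset.range n, F.l (e i) := by
      rw [← Fin.prod_univ_eq_prod_range (fun i => F.l (e i))]
      exact Finset.prod_congr rfl fun i _ => by rw [he i]
    rw [this]
    exact F.abs_code_sub_le fun i hi => (he ⟨i, hi⟩).trans (he' ⟨i, hi⟩).symm
  have key := MeasureTheory.Measure.hausdorffMeasure_le_liminf_sum (X := ℝ) (d : ℝ)
    (range F.code) (l := atTop)
    (fun n : ℕ => ENNReal.ofReal ((1 / 2) ^ n)) (by
      rw [← ENNReal.ofReal_zero]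
      exact (ENNReal.continuous_ofReal.tendsto 0).comp
        (tendsto_pow_atTop_nhds_zero_of_lt_one (by norm_num) (by norm_num)))
    t (Eventually.of_forall fun n w => (hdiam n w).trans (ENNReal.ofReal_le_ofReal (by
      calc ∏ i, F.l (w i) ≤ ∏ i : Fin n, (1 / 2 : ℝ) :=
            Finset.prod_le_prod (fun i _ => (F.l_pos _).le) fun i _ => F.l_le _
        _ = _ := by simp)))
    (Eventually.of_forall fun n => by
      rintro _ ⟨e, rfl⟩
      exact mem_iUnion.2 ⟨fun i => e i, e, fun i => rfl, rfl⟩)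
  refine dimH_le_of_hausdorffMeasure_ne_top (ne_top_of_le_ne_top ENNReal.one_ne_top
    (key.trans ?_))
  rw [← liminf_const (f := (atTop : Filter ℕ)) (1 : ℝ≥0∞)]
  refine liminf_le_liminf (Eventually.of_forall fun n => ?_)
  calc ∑ w, Metric.ediam (t n w) ^ (d : ℝ)
      ≤ ∑ w : Fin n → Bool, ENNReal.ofReal (∏ i, F.l (w i) ^ (d : ℝ)) := by
        refine Finset.sum_le_sum fun w _ => ?_
        rw [Real.finsetProd_rpow _ _ fun i _ => (F.l_pos _).le,
          ← ENNReal.ofReal_rpow_of_nonneg (p := (d : ℝ))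
            (Finset.prod_nonneg fun i _ => (F.l_pos _).le) d.2]
        exact ENNReal.rpow_le_rpow (hdiam n w) d.2
    _ = ENNReal.ofReal ((F.l false ^ (d : ℝ) + F.l true ^ (d : ℝ)) ^ n) := by
        rw [← ENNReal.ofReal_sum_of_nonneg fun w _ =>
          Finset.prod_nonneg fun i _ => Real.rpow_nonneg (F.l_pos _).le _]
        congr 1
        rw [add_comm (F.l false ^ (d : ℝ)), ← Fintype.sum_bool (fun b => F.l b ^ (d : ℝ)),
          Fintype.sum_pow]
    _ ≤ 1 := by
        rw [← ENNReal.ofReal_one]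
        refine ENNReal.ofReal_le_ofReal (pow_le_one₀ ?_ hd)
        have h1 := Real.rpow_nonneg (F.l_pos false).le (d : ℝ)
        have h2 := Real.rpow_nonneg (F.l_pos true).le (d : ℝ)
        positivity

/-! ### Symbolic coding of survivor sets -/

/-- The two inverse branches of `T_k` with digits `0` and `k - 1`. -/
def digitIfs (k : ℕ) (hk : 2 ≤ k) : Ifs where
  c i := if i then ((k : ℝ) - 1) / k else 0
  l _ := 1 / k
  c_nonneg i := by
    have : (2 : ℝ) ≤ k := by exact_mod_cast hk
    split_ifs
    · exact div_nonneg (by linarith) (by linarith)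
    · exact le_rfl
  l_pos i := by
    have : (2 : ℝ) ≤ k := by exact_mod_cast hk
    positivity
  l_le i := by
    have : (2 : ℝ) ≤ k := by exact_mod_cast hk
    exact one_div_le_one_div_of_le (by norm_num) this
  le_one i := by
    have : (2 : ℝ) ≤ k := by exact_mod_cast hk
    split_ifs
    · rw [← add_div, sub_add_cancel, div_self (by positivity)]
    · rw [zero_add, div_le_one (by positivity)]; linarith

lemma digitIfs_map_false {k : ℕ} (hk : 2 ≤ k) (x : ℝ) :
    (digitIfs k hk).map false x = x / k := by
  simp [digitIfs, Ifs.map, div_eq_inv_mul]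

lemma digitIfs_map_true {k : ℕ} (hk : 2 ≤ k) (x : ℝ) :
    (digitIfs k hk).map true x = ((k : ℝ) - 1 + x) / k := by
  simp only [digitIfs, Ifs.map, if_true]; ring

lemma expandingMap_digitIfs_map {k : ℕ} (hk : 2 ≤ k) (i : Bool) {x : ℝ} (hx : x ∈ Ico (0 : ℝ) 1) :
    expandingMap k ((digitIfs k hk).map i x) = x := by
  have hk0 : (k : ℝ) ≠ 0 := by positivity
  cases i
  · rw [digitIfs_map_false, expandingMap, mul_div_cancel₀ _ hk0]
    exact Int.fract_eq_self.2 hx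
  · rw [digitIfs_map_true, expandingMap, mul_div_cancel₀ _ hk0]
    have : (k : ℝ) - 1 + x = x + ((k - 1 : ℤ) : ℝ) := by push_cast; ring
    rw [this, Int.fract_add_intCast]
    exact Int.fract_eq_self.2 hx

lemma expandingMap_mem (k : ℕ) (x : ℝ) : expandingMap k x ∈ Ico (0 : ℝ) 1 :=
  ⟨Int.fract_nonneg _, Int.fract_lt_one _⟩

lemma iterate_expandingMap_mem (k : ℕ) {x : ℝ} (hx : x ∈ Ico (0 : ℝ) 1) (n : ℕ) :
    (expandingMap k)^[n] x ∈ Ico (0 : ℝ) 1 := by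
  cases n with
  | zero => exact hx
  | succ n => rw [Function.iterate_succ_apply']; exact expandingMap_mem _ _

namespace Ifs

lemma code_pos (F : Ifs) (hF : 0 < F.c true) {e : ℕ → Bool} {m : ℕ} (h : e m = true) :
    0 < F.code e := by
  induction m generalizing e with
  | zero =>
    rw [code_eq, h, map]
    have h1 := F.l_pos true
    have h2 := (F.code_mem (shift 1 e)).1
    positivity
  | succ m ih =>
    rw [code_eq, map]
    have h1 := F.l_pos (e 0)
    have h2 := F.c_nonneg (e 0)
    have h3 : 0 < F.code (shift 1 e) := ih (e := shift 1 e) h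
    positivity

lemma code_lt_one (F : Ifs) (hF : F.c false + F.l false < 1) {e : ℕ → Bool} {m : ℕ}
    (h : e m = false) : F.code e < 1 := by
  induction m generalizing e with
  | zero =>
    rw [code_eq, h, map]
    have h1 := F.l_pos false
    have h2 := (F.code_mem (shift 1 e)).2
    nlinarith
  | succ m ih =>
    rw [code_eq, map]
    have h1 := F.l_pos (e 0)
    have h2 := F.le_one (e 0)
    have h3 : F.code (shift 1 e) < 1 := ih (e := shift 1 e) h
    nlinarith

end Ifs

lemma digitIfs_code_pos {k : ℕ} (hk : 2 ≤ k) {e : ℕ → Bool} {m : ℕ} (h : e m = true) :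
    0 < (digitIfs k hk).code e := by
  refine Ifs.code_pos _ ?_ h
  have : (2 : ℝ) ≤ k := by exact_mod_cast hk
  simp only [digitIfs, if_true]
  exact div_pos (by linarith) (by linarith)

lemma digitIfs_code_lt_one {k : ℕ} (hk : 2 ≤ k) {e : ℕ → Bool} {m : ℕ} (h : e m = false) :
    (digitIfs k hk).code e < 1 := by
  refine Ifs.code_lt_one _ ?_ h
  have : (2 : ℝ) ≤ k := by exact_mod_cast hk
  simp only [digitIfs]
  simp only [Bool.false_eq_true, if_false, zero_add]
  rw [div_lt_one (by linarith)]; linarith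

/-- Each point that survives a hole `(a, b)` containing `[1/k, (k-1)/k]` has a `0`-`1` coding, whose
letters tell on which side of the hole the points of the orbit lie. -/
lemma exists_code_of_mem_survivorSet {k : ℕ} (hk : 2 ≤ k) {a b : ℝ} (ha : a < 1 / (k : ℝ))
    (hb : ((k : ℝ) - 1) / k < b) {x : ℝ} (hx : x ∈ survivorSet k a b) :
    ∃ e : ℕ → Bool, x = (digitIfs k hk).code e ∧
      ∀ n, (e n = false → (digitIfs k hk).code (shift n e) ≤ a) ∧
        (e n = true → b ≤ (digitIfs k hk).code (shift n e)) := by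
  classical
  have hk0 : (0 : ℝ) < k := by positivity
  have hkc : (1 : ℝ) ≤ k := by exact_mod_cast (by omega : 1 ≤ k)
  let e : ℕ → Bool := fun n => decide (b ≤ (expandingMap k)^[n] x)
  have hmem := iterate_expandingMap_mem k hx.1
  have hle : ∀ n, e n = false → (expandingMap k)^[n] x ≤ a := by
    intro n hn
    have h1 : ¬ b ≤ (expandingMap k)^[n] x := by simpa [e] using hn
    by_contra h2
    exact hx.2 n ⟨not_le.1 h2, not_le.1 h1⟩
  have hge : ∀ n, e n = true → b ≤ (expandingMap k)^[n] x := by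
    intro n hn; simpa [e] using hn
  have hcode := (digitIfs k hk).code_unique (e := e) (u := fun n => (expandingMap k)^[n] x)
    (fun n => Ico_subset_Icc_self (hmem n)) (fun n => by
      have hm := hmem n
      simp only [Function.iterate_succ_apply']
      set y := (expandingMap k)^[n] x with hy
      cases hn : e n
      · have h1 := hle n hn
        rw [digitIfs_map_false, expandingMap]
        have h2 : (k : ℝ) * y < 1 := by
          rw [lt_div_iff₀ hk0] at ha; nlinarith
        rw [Int.fract_eq_self.2 ⟨mul_nonneg hk0.le hm.1, h2⟩]
        field_simp
      · have h1 := hge n hn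
        rw [digitIfs_map_true, expandingMap]
        rw [div_lt_iff₀ hk0] at hb
        have h2 : Int.fract ((k : ℝ) * y) = k * y - (k - 1) := by
          rw [Int.fract_eq_iff]
          refine ⟨by nlinarith, by nlinarith [hm.2], k - 1, by push_cast; ring⟩
        rw [h2]
        field_simp
        ring)
  refine ⟨e, by simpa using hcode 0, fun n => ?_⟩
  rw [← hcode n]
  exact ⟨hle n, hge n⟩

/-- Both letters occur infinitely often. -/
def Recurrent (e : ℕ → Bool) : Prop := ∀ i : Bool, ∀ n, ∃ m, e (m + n) = i

lemma Recurrent.shift {e : ℕ → Bool} (h : Recurrent e) (n : ℕ) : Recurrent (shift n e) := by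
  intro i m
  obtain ⟨p, hp⟩ := h i (m + n)
  exact ⟨p, by rw [shift_apply, add_assoc]; exact hp⟩

lemma countable_not_recurrent : {e : ℕ → Bool | ¬ Recurrent e}.Countable := by
  classical
  let f : (Σ n : ℕ, Fin n → Bool) × Bool → (ℕ → Bool) := fun p i =>
    if h : i < p.1.1 then p.1.2 ⟨i, h⟩ else p.2
  refine (countable_range f).mono ?_
  intro e he
  simp only [Recurrent, mem_ofPred_eq, not_forall, not_exists] at he
  obtain ⟨i, n, h⟩ := he
  refine ⟨⟨⟨n, fun j => e j⟩, !i⟩, ?_⟩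
  funext j
  by_cases hj : j < n
  · simp [f, hj]
  · have := h (j - n)
    rw [Nat.sub_add_cancel (not_lt.1 hj)] at this
    simp only [f, hj, dite_false]
    cases i <;> cases h' : e j <;> simp_all

/-- The codings with infinitely many of both letters of points that survive the hole `(a, b)`. -/
def survivorCodes (k : ℕ) (hk : 2 ≤ k) (a b : ℝ) : Set (ℕ → Bool) :=
  {e | Recurrent e ∧ ∀ n, (digitIfs k hk).code (shift n e) ∉ Ioo a b}

lemma iterate_expandingMap_code {k : ℕ} (hk : 2 ≤ k) {e : ℕ → Bool} (he : Recurrent e) (n : ℕ) :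
    (expandingMap k)^[n] ((digitIfs k hk).code e) = (digitIfs k hk).code (shift n e) := by
  induction n with
  | zero => rfl
  | succ n ih =>
    rw [Function.iterate_succ_apply', ih, Ifs.code_shift, expandingMap_digitIfs_map]
    obtain ⟨m, hm⟩ := he false (n + 1)
    exact ⟨((digitIfs k hk).code_mem _).1, digitIfs_code_lt_one hk (m := m) hm⟩

/-- Up to countably many points the survivor set is the set of points coded by `survivorCodes`. -/
lemma survivorDim_eq {k : ℕ} (hk : 2 ≤ k) {a b : ℝ} (ha : a < 1 / (k : ℝ))
    (hb : ((k : ℝ) - 1) / k < b) :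
    survivorDim k a b = dimH ((digitIfs k hk).code '' survivorCodes k hk a b) := by
  apply le_antisymm
  · have hsub : survivorSet k a b ⊆ (digitIfs k hk).code '' survivorCodes k hk a b ∪
        (digitIfs k hk).code '' {e | ¬ Recurrent e} := by
      intro x hx
      obtain ⟨e, rfl, he⟩ := exists_code_of_mem_survivorSet hk ha hb hx
      by_cases hr : Recurrent e
      · refine Or.inl ⟨e, ⟨hr, fun n => ?_⟩, rfl⟩
        cases h : e n
        · exact fun h' => absurd ((he n).1 h) (not_le.2 h'.1)
        · exact fun h' => absurd ((he n).2 h) (not_le.2 h'.2)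
      · exact Or.inr ⟨e, hr, rfl⟩
    refine (dimH_mono hsub).trans ?_
    rw [dimH_union, dimH_countable (countable_not_recurrent.image _)]
    simp
  · refine dimH_mono ?_
    rintro _ ⟨e, ⟨hr, he⟩, rfl⟩
    refine ⟨⟨((digitIfs k hk).code_mem _).1, ?_⟩, fun n => ?_⟩
    · obtain ⟨m, hm⟩ := hr false 0
      exact digitIfs_code_lt_one hk hm
    · rw [iterate_expandingMap_code hk hr]
      exact he n

/-- The letters of a coding in `survivorCodes` tell the side of the hole. -/
lemma survivorCodes_side {k : ℕ} (hk : 2 ≤ k) {a b : ℝ} (ha : a < 1 / (k : ℝ))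
    (hb : ((k : ℝ) - 1) / k < b) {e : ℕ → Bool} (he : e ∈ survivorCodes k hk a b) (n : ℕ) :
    (e n = false → (digitIfs k hk).code (shift n e) ≤ a) ∧
      (e n = true → b ≤ (digitIfs k hk).code (shift n e)) := by
  have hk0 : (0 : ℝ) < k := by positivity
  have hk2 : (2 : ℝ) ≤ k := by exact_mod_cast hk
  have h2 := (digitIfs k hk).code_mem (shift (n + 1) e)
  have h3 : 1 / (k : ℝ) ≤ (k - 1) / k := by gcongr; linarith
  refine ⟨fun h => ?_, fun h => ?_⟩
  · by_contra h1
    refine he.2 n ⟨not_le.1 h1, ?_⟩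
    rw [Ifs.code_shift, h, digitIfs_map_false]
    have : (digitIfs k hk).code (shift (n + 1) e) / k ≤ 1 / k := by
      gcongr; exact h2.2
    linarith
  · by_contra h1
    refine he.2 n ⟨?_, not_le.1 h1⟩
    rw [Ifs.code_shift, h, digitIfs_map_true]
    have : ((k : ℝ) - 1) / k ≤ (k - 1 + (digitIfs k hk).code (shift (n + 1) e)) / k := by
      gcongr; linarith [h2.1]
    linarith

/-- A set of codings with a gap between the values of the tails that begin with `0` and of those
that begin with `1`: the change of base is Hölder. -/
lemma dimH_code_le_of_gap {k j : ℕ} (hk : 2 ≤ k) (hj : 2 ≤ j) {S : Set (ℕ → Bool)} {a b : ℝ}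
    (hab : a < b) (hS : ∀ e ∈ S, ∀ n, (e n = false → (digitIfs k hk).code (shift n e) ≤ a) ∧
      (e n = true → b ≤ (digitIfs k hk).code (shift n e))) :
    dimH ((digitIfs j hj).code '' S) ≤
      dimH ((digitIfs k hk).code '' S) / ENNReal.ofReal (Real.logb k j) := by
  have hk0 : (0 : ℝ) < k := by positivity
  have hk1 : (1 : ℝ) < k := by exact_mod_cast (by omega : 1 < k)
  have hj1 : (1 : ℝ) < j := by exact_mod_cast (by omega : 1 < j)
  have hprod : ∀ (m : ℕ) (hm : 2 ≤ m) (e : ℕ → Bool) (n : ℕ),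
      ∏ i ∈ Finset.range n, (digitIfs m hm).l (e i) = (1 / (m : ℝ)) ^ n := by
    intro m hm e n; simp [digitIfs]
  refine dimH_image_le_of_separated (δ := b - a) (lam := 1 / k) (sub_pos.2 hab) (by positivity)
    (Real.logb_pos hk1 hj1) (fun e he e' he' n hn h0 h1 => ?_) (fun e _ e' _ n hn => ?_)
  · have h2 := (hS e he n).1 h0
    have h3 := (hS e' he' n).2 h1
    rw [Ifs.code_sub _ n hn, hprod, abs_mul, abs_of_pos (a := (1 / (k : ℝ)) ^ n) (by positivity),
      mul_comm, abs_sub_comm]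
    have : b - a ≤ |(digitIfs k hk).code (shift n e') - (digitIfs k hk).code (shift n e)| :=
      le_trans (by linarith) (le_abs_self _)
    gcongr
  · have h := (digitIfs j hj).abs_code_sub_le hn
    rw [hprod] at h
    have : (1 / (k : ℝ)) ^ Real.logb k j = 1 / j := by
      rw [Real.div_rpow zero_le_one hk0.le, Real.one_rpow,
        Real.rpow_logb hk0 hk1.ne' (by linarith)]
    rwa [this]

/-! ### The generalized Cantor function -/

lemma digit_lt {k : ℕ} (hk : 2 ≤ k) (x : ℝ) (n : ℕ) : digit k x n ≤ k - 1 := by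
  unfold digit
  split_ifs
  · exact le_rfl
  · have := Nat.mod_lt ⌊x * (k : ℝ) ^ (n + 1)⌋₊ (by omega : k > 0)
    omega

lemma cantorFun_term_le {k : ℕ} (hk : 2 ≤ k) (x : ℝ) (n : ℕ) :
    (digit k x n : ℝ) / (((k : ℝ) - 1) * 2 ^ (n + 1)) ≤ (1 / 2) ^ (n + 1) := by
  have h1 : (digit k x n : ℝ) ≤ (k : ℝ) - 1 := by
    have := digit_lt hk x n
    have h2 : ((digit k x n : ℕ) : ℝ) ≤ ((k - 1 : ℕ) : ℝ) := by exact_mod_cast this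
    rwa [Nat.cast_sub (by omega), Nat.cast_one] at h2
  have h3 : (2 : ℝ) ≤ k := by exact_mod_cast hk
  rw [one_div_pow, div_le_div_iff₀ (by apply mul_pos (by linarith); positivity) (by positivity)]
  have : (0 : ℝ) < 2 ^ (n + 1) := by positivity
  nlinarith

lemma cantorFun_term_nonneg {k : ℕ} (hk : 2 ≤ k) (x : ℝ) (n : ℕ) :
    0 ≤ (digit k x n : ℝ) / (((k : ℝ) - 1) * 2 ^ (n + 1)) := by
  have h3 : (2 : ℝ) ≤ k := by exact_mod_cast hk
  have : (0 : ℝ) ≤ (k : ℝ) - 1 := by linarith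
  positivity

lemma summable_half_pow_succ : Summable fun n : ℕ => (1 / 2 : ℝ) ^ (n + 1) :=
  (summable_nat_add_iff 1).2 (summable_geometric_of_lt_one (by norm_num) (by norm_num))

lemma tsum_half_pow_succ : ∑' n : ℕ, (1 / 2 : ℝ) ^ (n + 1) = 1 := by
  simp_rw [pow_succ]
  rw [tsum_mul_right, tsum_geometric_two]; norm_num

lemma summable_cantorFun {k : ℕ} (hk : 2 ≤ k) (x : ℝ) :
    Summable fun n => (digit k x n : ℝ) / (((k : ℝ) - 1) * 2 ^ (n + 1)) :=
  Summable.of_nonneg_of_le (cantorFun_term_nonneg hk x) (cantorFun_term_le hk x)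
    summable_half_pow_succ

lemma cantorFun_mem {k : ℕ} (hk : 2 ≤ k) (x : ℝ) : cantorFun k x ∈ Icc (0 : ℝ) 1 := by
  unfold cantorFun
  split_ifs with h
  · constructor
    · have := Finset.sum_nonneg (s := Finset.range (Nat.find h))
        fun n _ => cantorFun_term_nonneg hk x n
      positivity
    · have h1 := Finset.sum_le_sum (s := Finset.range (Nat.find h))
        fun n _ => cantorFun_term_le hk x n
      have h2 : ∀ N : ℕ, ∑ n ∈ Finset.range N, (1 / 2 : ℝ) ^ (n + 1) = 1 - (1 / 2) ^ N := by
        intro N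
        induction N with
        | zero => simp
        | succ N ih => rw [Finset.sum_range_succ, ih, pow_succ]; ring
      rw [h2] at h1
      have h3 : (1 : ℝ) / 2 ^ (Nat.find h + 1) = (1 / 2) ^ Nat.find h / 2 := by
        rw [one_div_pow, pow_succ]; field_simp
      have h4 : (0 : ℝ) < (1 / 2) ^ Nat.find h := by positivity
      rw [h3]; linarith
  · refine ⟨tsum_nonneg (cantorFun_term_nonneg hk x), ?_⟩
    exact ((summable_cantorFun hk x).tsum_le_tsum (cantorFun_term_le hk x)
      summable_half_pow_succ).trans_eq tsum_half_pow_succ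

lemma cantorFun_of_first {k N : ℕ} {x : ℝ} (hN : digit k x N ≠ 0 ∧ digit k x N ≠ k - 1)
    (hlt : ∀ n < N, ¬ (digit k x n ≠ 0 ∧ digit k x n ≠ k - 1)) :
    cantorFun k x = (∑ n ∈ Finset.range N, (digit k x n : ℝ) / (((k : ℝ) - 1) * 2 ^ (n + 1)))
      + 1 / 2 ^ (N + 1) := by
  unfold cantorFun
  rw [dif_pos ⟨N, hN⟩, (Nat.find_eq_iff _).2 ⟨hN, hlt⟩]

/-- Removing a first digit `0` or `k - 1`. -/
lemma cantorFun_of_digit {k : ℕ} (hk : 2 ≤ k) {x y : ℝ}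
    (h0 : digit k x 0 = 0 ∨ digit k x 0 = k - 1)
    (hs : ∀ n, digit k x (n + 1) = digit k y n) :
    cantorFun k x = ((digit k x 0 : ℝ) / ((k : ℝ) - 1) + cantorFun k y) / 2 := by
  classical
  have h3 : (2 : ℝ) ≤ k := by exact_mod_cast hk
  have h4 : (k : ℝ) - 1 ≠ 0 := by linarith
  have hterm : ∀ n, (digit k x (n + 1) : ℝ) / (((k : ℝ) - 1) * 2 ^ (n + 1 + 1)) =
      (digit k y n : ℝ) / (((k : ℝ) - 1) * 2 ^ (n + 1)) / 2 := by
    intro n; rw [hs, pow_succ 2 (n + 1)]; field_simp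
  by_cases h : ∃ n, digit k y n ≠ 0 ∧ digit k y n ≠ k - 1
  · have hN := Nat.find_spec h
    have hlt := fun n hn => Nat.find_min (m := n) h hn
    set N := Nat.find h
    rw [cantorFun_of_first hN hlt, cantorFun_of_first (N := N + 1) (by rwa [hs]) (fun n hn => by
        cases n with
        | zero => tauto
        | succ n => rw [hs]; exact hlt n (by omega)),
      Finset.sum_range_succ', Finset.sum_congr rfl fun n _ => hterm n, ← Finset.sum_div,
      pow_succ 2 (N + 1)]
    field_simp
    ring
  · have h' : ¬ ∃ n, digit k x n ≠ 0 ∧ digit k x n ≠ k - 1 := by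
      rintro ⟨n, hn⟩
      cases n with
      | zero => tauto
      | succ n => exact h ⟨n, by rwa [← hs]⟩
    unfold cantorFun
    rw [dif_neg h', dif_neg h, (summable_cantorFun hk x).tsum_eq_zero_add, tsum_congr hterm,
      tsum_div_const]
    field_simp
    ring

lemma floor_mul_pow_mod {k : ℕ} (hk : 2 ≤ k) {x : ℝ} (hx : 0 ≤ x) (m n : ℕ) :
    ⌊(x + m) * (k : ℝ) ^ (n + 1)⌋₊ % k = ⌊x * (k : ℝ) ^ (n + 1)⌋₊ % k := by
  have : (x + m) * (k : ℝ) ^ (n + 1) = x * (k : ℝ) ^ (n + 1) + ((m * k ^ (n + 1) : ℕ) : ℝ) := by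
    push_cast; ring
  rw [this, Nat.floor_add_natCast (by positivity), pow_succ k, ← mul_assoc,
    Nat.add_mul_mod_self_right]

lemma digit_zero_of_mem {k m : ℕ} {x : ℝ} (hm : m < k) (h1 : (m : ℝ) ≤ k * x)
    (h2 : k * x < m + 1) : digit k x 0 = m := by
  have hk0 : (0 : ℝ) < k := by exact_mod_cast (by omega : 0 < k)
  have hx : x ≠ 1 := by
    rintro rfl
    have : ((m : ℝ) + 1) ≤ k := by exact_mod_cast hm
    linarith
  have : ⌊x * (k : ℝ) ^ (0 + 1)⌋₊ = m := by
    rw [Nat.floor_eq_iff (by rw [zero_add, pow_one]; linarith [(Nat.cast_nonneg m : (0 : ℝ) ≤ m)])]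
    constructor <;> [skip; skip] <;> rw [zero_add, pow_one] <;> linarith
  rw [digit, if_neg hx, this, Nat.mod_eq_of_lt hm]

lemma digit_succ_of_mem {k m : ℕ} (hk : 2 ≤ k) {x : ℝ} (hm : m < k) (h1 : (m : ℝ) ≤ k * x)
    (h2 : k * x < m + 1) (n : ℕ) : digit k x (n + 1) = digit k (k * x - m) n := by
  have hx : x ≠ 1 := by
    rintro rfl
    have : ((m : ℝ) + 1) ≤ k := by exact_mod_cast hm
    linarith
  have hy : (k : ℝ) * x - m ≠ 1 := by intro h; linarith
  rw [digit, digit, if_neg hx, if_neg hy, ← floor_mul_pow_mod hk (by linarith) m n]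
  congr 2
  ring

lemma cantorFun_low {k : ℕ} (hk : 2 ≤ k) {x : ℝ} (h0 : 0 ≤ x) (h1 : k * x < 1) :
    cantorFun k x = cantorFun k (k * x) / 2 := by
  have hkx : ((0 : ℕ) : ℝ) ≤ k * x := by simp; positivity
  have hd := digit_zero_of_mem (k := k) (m := 0) (x := x) (by omega) hkx (by simpa using h1)
  have hs := digit_succ_of_mem (k := k) (m := 0) (x := x) hk (by omega) hkx (by simpa using h1)
  rw [cantorFun_of_digit hk (y := k * x) (Or.inl hd) (by simpa using hs), hd]
  simp

lemma cantorFun_high {k : ℕ} (hk : 2 ≤ k) {x : ℝ} (h0 : (k : ℝ) - 1 ≤ k * x) (h1 : x ≤ 1) :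
    cantorFun k x = (1 + cantorFun k (k * x - (k - 1))) / 2 := by
  have h3 : (2 : ℝ) ≤ k := by exact_mod_cast hk
  have hc : ((k - 1 : ℕ) : ℝ) = k - 1 := by rw [Nat.cast_sub (by omega), Nat.cast_one]
  have hd1 : ∀ n, digit k 1 n = k - 1 := fun n => by rw [digit, if_pos rfl]
  rcases h1.lt_or_eq with h1 | rfl
  · have h4 : (k : ℝ) * x < ((k - 1 : ℕ) : ℝ) + 1 := by rw [hc]; nlinarith
    have hd := digit_zero_of_mem (k := k) (m := k - 1) (x := x) (by omega) (by rwa [hc]) h4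
    have hs := digit_succ_of_mem (k := k) (m := k - 1) (x := x) hk (by omega) (by rwa [hc]) h4
    rw [cantorFun_of_digit hk (y := k * x - (k - 1)) (Or.inr hd) (by rwa [hc] at hs), hd, hc,
      div_self (by linarith)]
  · have : (k : ℝ) * 1 - (k - 1) = 1 := by ring
    rw [this]
    conv_lhs => rw [cantorFun_of_digit hk (x := 1) (y := 1) (Or.inr (hd1 0))
      (fun n => by rw [hd1, hd1]), hd1, hc, div_self (by linarith)]

lemma cantorFun_middle {k : ℕ} (hk : 2 ≤ k) {x : ℝ} (h0 : 1 ≤ k * x) (h1 : k * x < (k : ℝ) - 1) :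
    cantorFun k x = 1 / 2 := by
  classical
  have h3 : (2 : ℝ) ≤ k := by exact_mod_cast hk
  have hc : ((k - 1 : ℕ) : ℝ) = k - 1 := by rw [Nat.cast_sub (by omega), Nat.cast_one]
  have hf1 : 1 ≤ ⌊(k : ℝ) * x⌋₊ := Nat.le_floor (by simpa using h0)
  have hf2 : ⌊(k : ℝ) * x⌋₊ < k - 1 := (Nat.floor_lt (by linarith)).2 (by rwa [hc])
  have hd := digit_zero_of_mem (k := k) (x := x) (m := ⌊(k : ℝ) * x⌋₊) (by omega)
    (Nat.floor_le (by linarith)) (Nat.lt_floor_add_one _)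
  rw [cantorFun_of_first (N := 0) (by rw [hd]; omega) (by simp)]
  simp

/-- The codings with base-`k` digits `0` and `k - 1` and with base-`2` digits are compared with a
point and with its image under the Cantor function in the same way. -/
lemma cantorFun_compare {k : ℕ} (hk : 2 ≤ k) {e : ℕ → Bool} {x : ℝ} (hx : x ∈ Icc (0 : ℝ) 1) :
    ((digitIfs k hk).code e ≤ x → (digitIfs 2 le_rfl).code e ≤ cantorFun k x) ∧
      (x ≤ (digitIfs k hk).code e → cantorFun k x ≤ (digitIfs 2 le_rfl).code e) := by
  have h3 : (2 : ℝ) ≤ k := by exact_mod_cast hk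
  have hk0 : (0 : ℝ) < k := by linarith
  have key : ∀ n e x, x ∈ Icc (0 : ℝ) 1 →
      ((digitIfs k hk).code e ≤ x →
        (digitIfs 2 le_rfl).code e ≤ cantorFun k x + (1 / 2) ^ n) ∧
      (x ≤ (digitIfs k hk).code e →
        cantorFun k x ≤ (digitIfs 2 le_rfl).code e + (1 / 2) ^ n) := by
    intro n
    induction n with
    | zero =>
      intro e x hx
      have h1 := (digitIfs 2 le_rfl).code_mem e
      have h2 := cantorFun_mem hk x
      constructor <;> intro <;> rw [pow_zero] <;> linarith [h1.1, h1.2, h2.1, h2.2]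
    | succ n ih =>
      intro e x hx
      have hp : (0 : ℝ) < (1 / 2) ^ n := by positivity
      rw [Ifs.code_eq, (digitIfs 2 le_rfl).code_eq, pow_succ]
      have hm2 := (digitIfs 2 le_rfl).code_mem (shift 1 e)
      have hmk := (digitIfs k hk).code_mem (shift 1 e)
      rcases lt_or_ge ((k : ℝ) * x) 1 with hlow | hlow
      · have hx' : (k : ℝ) * x ∈ Icc (0 : ℝ) 1 := ⟨mul_nonneg hk0.le hx.1, hlow.le⟩
        rw [cantorFun_low hk hx.1 hlow]
        have hg := cantorFun_mem hk (k * x)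
        cases e 0
        · simp only [digitIfs_map_false, div_le_iff₀ hk0, le_div_iff₀ hk0, mul_comm x,
            Nat.cast_ofNat]
          exact ⟨fun h => by linarith [(ih (shift 1 e) _ hx').1 h],
            fun h => by linarith [(ih (shift 1 e) _ hx').2 h]⟩
        · simp only [digitIfs_map_true, div_le_iff₀ hk0, le_div_iff₀ hk0, mul_comm x,
            Nat.cast_ofNat]
          exact ⟨fun h => by linarith [hmk.1], fun h => by linarith [hg.2, hm2.1]⟩
      rcases lt_or_ge ((k : ℝ) * x) (k - 1) with hmid | hmid
      · rw [cantorFun_middle hk hlow hmid]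
        cases e 0
        · simp only [digitIfs_map_false, div_le_iff₀ hk0, le_div_iff₀ hk0, mul_comm x,
            Nat.cast_ofNat]
          exact ⟨fun h => by linarith [hm2.2], fun h => by
            have : (digitIfs k hk).code (shift 1 e) = 1 := by linarith [hmk.2]
            have h1 : (k : ℝ) * x = 1 := by linarith
            have h5 := (ih (shift 1 e) 1 ⟨zero_le_one, le_rfl⟩).2 this.ge
            have h6 : cantorFun k 1 = 1 := by
              have := cantorFun_high hk (x := 1) (by linarith) le_rfl
              rw [mul_one, sub_sub_cancel] at this
              linarith
            linarith⟩
        · simp only [digitIfs_map_true, div_le_iff₀ hk0, le_div_iff₀ hk0, mul_comm x,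
            Nat.cast_ofNat]
          exact ⟨fun h => by linarith [hmk.1], fun h => by linarith [hm2.1]⟩
      · have hx' : (k : ℝ) * x - (k - 1) ∈ Icc (0 : ℝ) 1 :=
          ⟨by linarith, by nlinarith [hx.2]⟩
        rw [cantorFun_high hk hmid hx.2]
        have hg := cantorFun_mem hk (k * x - (k - 1))
        cases e 0
        · simp only [digitIfs_map_false, div_le_iff₀ hk0, le_div_iff₀ hk0, mul_comm x,
            Nat.cast_ofNat]
          refine ⟨fun h => by linarith [hm2.2, hg.1], fun h => ?_⟩
          -- only the common endpoint of the two outer intervals remains, which exists only for `k = 2`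
          have h7 : (digitIfs k hk).code (shift 1 e) = 1 := by linarith [hmk.2]
          have h8 : (k : ℝ) * x - (k - 1) = 0 := by linarith [hmk.2]
          have h5 := (ih (shift 1 e) 1 ⟨zero_le_one, le_rfl⟩).2 h7.ge
          have h6 : cantorFun k 1 = 1 := by
            have := cantorFun_high hk (x := 1) (by linarith) le_rfl
            rw [mul_one, sub_sub_cancel] at this
            linarith
          have h9 : cantorFun k 0 = 0 := by
            have := cantorFun_low hk (x := 0) le_rfl (by simp)
            rw [mul_zero] at this
            linarith
          rw [h8, h9]; linarith
        · simp only [digitIfs_map_true, div_le_iff₀ hk0, le_div_iff₀ hk0, mul_comm x,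
            Nat.cast_ofNat]
          exact ⟨fun h => by linarith [(ih (shift 1 e) _ hx').1 (by linarith)],
            fun h => by linarith [(ih (shift 1 e) _ hx').2 (by linarith)]⟩
  have h4 : Tendsto (fun n : ℕ => (1 / 2 : ℝ) ^ n) atTop (𝓝 0) :=
    tendsto_pow_atTop_nhds_zero_of_lt_one (by norm_num) (by norm_num)
  have lim : ∀ u v : ℝ, (∀ n : ℕ, u ≤ v + (1 / 2) ^ n) → u ≤ v := fun u v h =>
    ge_of_tendsto' (by simpa using tendsto_const_nhds.add h4 :
      Tendsto (fun n : ℕ => v + (1 / 2 : ℝ) ^ n) atTop (𝓝 v)) h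
  exact ⟨fun h => lim _ _ fun n => (key n e x hx).1 h, fun h => lim _ _ fun n => (key n e x hx).2 h⟩

lemma digitIfs_code_prefix {k : ℕ} (hk : 2 ≤ k) {e e' : ℕ → Bool} {n : ℕ}
    (h : ∀ i < n, e i = e' i) : (digitIfs k hk).code e - (digitIfs k hk).code e' =
      (1 / (k : ℝ)) ^ n *
        ((digitIfs k hk).code (shift n e) - (digitIfs k hk).code (shift n e')) := by
  rw [Ifs.code_sub _ n h]
  congr 1
  simp [digitIfs]

lemma digitIfs_code_const_false {k : ℕ} (hk : 2 ≤ k) :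
    (digitIfs k hk).code (fun _ => false) = 0 := by
  have h := (digitIfs k hk).code_unique (e := fun _ => false) (u := fun _ => 0)
    (fun _ => ⟨le_rfl, zero_le_one⟩) (fun _ => by rw [digitIfs_map_false]; simp) 0
  simpa using h.symm

lemma digitIfs_code_const_true {k : ℕ} (hk : 2 ≤ k) :
    (digitIfs k hk).code (fun _ => true) = 1 := by
  have hk0 : (k : ℝ) ≠ 0 := by positivity
  have h := (digitIfs k hk).code_unique (e := fun _ => true) (u := fun _ => 1)
    (fun _ => ⟨zero_le_one, le_rfl⟩) (fun _ => by rw [digitIfs_map_true]; field_simp; ring) 0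
  simpa using h.symm

/-- For codings with infinitely many of both letters the comparison is an equivalence: a coding with
infinitely many `1`s can be lowered arbitrarily little, and one with infinitely many `0`s raised. -/
lemma cantorFun_compare_iff {k : ℕ} (hk : 2 ≤ k) {e : ℕ → Bool} (he : Recurrent e) {x : ℝ}
    (hx : x ∈ Icc (0 : ℝ) 1) :
    ((digitIfs k hk).code e ≤ x ↔ (digitIfs 2 le_rfl).code e ≤ cantorFun k x) ∧
      (x ≤ (digitIfs k hk).code e ↔ cantorFun k x ≤ (digitIfs 2 le_rfl).code e) := by
  have h3 : (2 : ℝ) ≤ k := by exact_mod_cast hk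
  have hlt1 : (1 / (k : ℝ)) < 1 := by rw [div_lt_one (by linarith)]; linarith
  refine ⟨⟨(cantorFun_compare hk hx).1, fun h => ?_⟩, ⟨(cantorFun_compare hk hx).2, fun h => ?_⟩⟩
  · by_contra hlt
    rw [not_le] at hlt
    obtain ⟨n, hn⟩ := exists_pow_lt_of_lt_one (sub_pos.2 hlt) hlt1
    let e' : ℕ → Bool := fun i => if i < n then e i else false
    have hee : ∀ i < n, e i = e' i := fun i hi => by simp [e', hi]
    have hsh : shift n e' = fun _ => false := by funext i; simp [e']
    have h1 := digitIfs_code_prefix hk hee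
    have h2 := digitIfs_code_prefix le_rfl hee
    rw [hsh, digitIfs_code_const_false, sub_zero] at h1 h2
    obtain ⟨m, hm⟩ := he true n
    have h4 : 0 < (digitIfs 2 le_rfl).code (shift n e) := digitIfs_code_pos le_rfl (m := m) hm
    have h5 : 0 < (1 / ((2 : ℕ) : ℝ)) ^ n * (digitIfs 2 le_rfl).code (shift n e) := by positivity
    have h6 := ((digitIfs k hk).code_mem (shift n e)).2
    have h7 : (1 / (k : ℝ)) ^ n * (digitIfs k hk).code (shift n e) ≤ (1 / (k : ℝ)) ^ n :=
      mul_le_of_le_one_right (by positivity) h6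
    have h8 := (cantorFun_compare hk (e := e') hx).2 (by linarith)
    linarith
  · by_contra hlt
    rw [not_le] at hlt
    obtain ⟨n, hn⟩ := exists_pow_lt_of_lt_one (sub_pos.2 hlt) hlt1
    let e' : ℕ → Bool := fun i => if i < n then e i else true
    have hee : ∀ i < n, e i = e' i := fun i hi => by simp [e', hi]
    have hsh : shift n e' = fun _ => true := by funext i; simp [e']
    have h1 := digitIfs_code_prefix hk hee
    have h2 := digitIfs_code_prefix le_rfl hee
    rw [hsh, digitIfs_code_const_true] at h1 h2
    obtain ⟨m, hm⟩ := he false n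
    have h4 : (digitIfs 2 le_rfl).code (shift n e) < 1 := digitIfs_code_lt_one le_rfl (m := m) hm
    have h5 : 0 < (1 / ((2 : ℕ) : ℝ)) ^ n * (1 - (digitIfs 2 le_rfl).code (shift n e)) :=
      mul_pos (by positivity) (by linarith)
    have h6 := ((digitIfs k hk).code_mem (shift n e)).1
    have h7 : (1 / (k : ℝ)) ^ n * (1 - (digitIfs k hk).code (shift n e)) ≤ (1 / (k : ℝ)) ^ n :=
      mul_le_of_le_one_right (by positivity) (by linarith)
    have h8 := (cantorFun_compare hk (e := e') hx).1 (by linarith)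
    linarith

lemma survivorCodes_cantorFun {k : ℕ} (hk : 2 ≤ k) {a b : ℝ} (ha : a ∈ Icc (0 : ℝ) 1)
    (hb : b ∈ Icc (0 : ℝ) 1) :
    survivorCodes 2 le_rfl (cantorFun k a) (cantorFun k b) = survivorCodes k hk a b := by
  ext e
  refine and_congr_right fun he => forall_congr' fun n => not_congr ?_
  rw [mem_Ioo, mem_Ioo, ← not_le, ← not_le, ← not_le, ← not_le,
    (cantorFun_compare_iff hk (he.shift n) ha).1, (cantorFun_compare_iff hk (he.shift n) hb).2]

lemma cantorFun_lt_half {k : ℕ} (hk : 2 ≤ k) {a : ℝ} (ha0 : 0 ≤ a) (ha : a < 1 / (k : ℝ)) :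
    cantorFun k a < 1 / 2 := by
  have h3 : (2 : ℝ) ≤ k := by exact_mod_cast hk
  have hlt1 : (1 / (k : ℝ)) < 1 := by rw [div_lt_one (by linarith)]; linarith
  rw [lt_div_iff₀ (by linarith)] at ha
  have ha' : (k : ℝ) * a < 1 := by linarith
  rw [cantorFun_low hk ha0 ha']
  obtain ⟨n, hn⟩ := exists_pow_lt_of_lt_one (sub_pos.2 ha') hlt1
  let e : ℕ → Bool := fun i => if i < n then true else false
  have hee : ∀ i < n, (fun _ => true) i = e i := fun i hi => by simp [e, hi]
  have hsh : shift n e = fun _ => false := by funext i; simp [e]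
  have hsh' : shift n (fun _ => true) = fun _ => true := rfl
  have h1 := digitIfs_code_prefix hk hee
  rw [hsh, hsh', digitIfs_code_const_false, digitIfs_code_const_true] at h1
  have h2 : (digitIfs 2 le_rfl).code e < 1 := digitIfs_code_lt_one le_rfl (m := n) (by simp [e])
  have h4 := (cantorFun_compare hk (e := e) (x := k * a)
    ⟨mul_nonneg (by linarith) ha0, ha'.le⟩).2 (by linarith)
  linarith

lemma half_lt_cantorFun {k : ℕ} (hk : 2 ≤ k) {b : ℝ} (hb : ((k : ℝ) - 1) / (k : ℝ) < b)
    (hb1 : b ≤ 1) : 1 / 2 < cantorFun k b := by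
  have h3 : (2 : ℝ) ≤ k := by exact_mod_cast hk
  have hlt1 : (1 / (k : ℝ)) < 1 := by rw [div_lt_one (by linarith)]; linarith
  rw [div_lt_iff₀ (by linarith)] at hb
  have hb' : 0 < (k : ℝ) * b - (k - 1) := by linarith
  rw [cantorFun_high hk (by linarith) hb1]
  obtain ⟨n, hn⟩ := exists_pow_lt_of_lt_one hb' hlt1
  let e : ℕ → Bool := fun i => if i < n then false else true
  have hee : ∀ i < n, (fun _ => false) i = e i := fun i hi => by simp [e, hi]
  have hsh : shift n e = fun _ => true := by funext i; simp [e]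
  have hsh' : shift n (fun _ => false) = fun _ => false := rfl
  have h1 := digitIfs_code_prefix hk hee
  rw [hsh, hsh', digitIfs_code_const_false, digitIfs_code_const_true] at h1
  have h2 : 0 < (digitIfs 2 le_rfl).code e := digitIfs_code_pos le_rfl (m := n) (by simp [e])
  have h4 := (cantorFun_compare hk (e := e) (x := k * b - (k - 1))
    ⟨hb'.le, by nlinarith⟩).1 (by linarith)
  linarith

/-- The gap around `1/2` makes the change of base bi-Hölder, so that the dimensions in base `k` and
in base `2` are proportional. -/
lemma survivorDim_cantorFun {k : ℕ} (hk : 2 ≤ k) {a b : ℝ} (ha0 : 0 ≤ a) (ha : a < 1 / (k : ℝ))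
    (hb : ((k : ℝ) - 1) / (k : ℝ) < b) (hb1 : b ≤ 1) :
    survivorDim k a b =
      ENNReal.ofReal (Real.logb k 2) * survivorDim 2 (cantorFun k a) (cantorFun k b) := by
  have h3 : (2 : ℝ) ≤ k := by exact_mod_cast hk
  have hab : 1 / (k : ℝ) ≤ (k - 1) / k := by gcongr; linarith
  have hga := cantorFun_lt_half hk ha0 ha
  have hgb := half_lt_cantorFun hk hb hb1
  have ha2 : cantorFun k a < 1 / ((2 : ℕ) : ℝ) := by simpa using hga
  have hb2 : (((2 : ℕ) : ℝ) - 1) / ((2 : ℕ) : ℝ) < cantorFun k b := by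
    refine lt_of_eq_of_lt ?_ hgb; norm_num
  have hb0 : 0 ≤ ((k : ℝ) - 1) / k := div_nonneg (by linarith) (by linarith)
  have hS := survivorCodes_cantorFun hk (a := a) (b := b) ⟨ha0, by linarith⟩ ⟨by linarith, hb1⟩
  have h1 := dimH_code_le_of_gap hk le_rfl (S := survivorCodes k hk a b) (by linarith : a < b)
    fun e he n => survivorCodes_side hk ha hb he n
  have h2 := dimH_code_le_of_gap le_rfl hk (S := survivorCodes k hk a b)
    (hga.trans hgb) fun e he n => survivorCodes_side le_rfl ha2 hb2 (hS ▸ he) n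
  rw [survivorDim_eq hk ha hb, survivorDim_eq le_rfl ha2 hb2, hS]
  have hlog : 0 < Real.logb k 2 := Real.logb_pos (by linarith) (by norm_num)
  have hinv : ENNReal.ofReal (Real.logb (2 : ℕ) k) = (ENNReal.ofReal (Real.logb k 2))⁻¹ := by
    rw [← ENNReal.ofReal_inv_of_pos hlog, Real.inv_logb, Nat.cast_ofNat]
  have hne : ENNReal.ofReal (Real.logb k 2) ≠ 0 := by simpa using hlog
  apply le_antisymm
  · rw [hinv, ENNReal.div_eq_inv_mul, inv_inv] at h2
    exact h2
  · rw [mul_comm]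
    rw [Nat.cast_ofNat] at h1
    exact (ENNReal.le_div_iff_mul_le (Or.inl hne) (Or.inl ENNReal.ofReal_ne_top)).1 h1

/-! ### Balanced words and elementary substitutions -/

/-- The substitution `0 ↦ s, 1 ↦ t` on words. -/
def subst (s t w : List ℕ) : List ℕ := w.flatMap fun c => if c = 0 then s else t

lemma subst_append (s t u v : List ℕ) : subst s t (u ++ v) = subst s t u ++ subst s t v := by
  simp [subst]

lemma subst_singleton_zero (s t : List ℕ) : subst s t [0] = s := by simp [subst]

lemma subst_singleton_one (s t : List ℕ) : subst s t [1] = t := by simp [subst]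

lemma subst_subst (s t u v w : List ℕ) :
    subst s t (subst u v w) = subst (subst s t u) (subst s t v) w := by
  simp only [subst, List.flatMap_assoc]
  congr 1
  funext c
  split_ifs <;> rfl

lemma subst_zero_one {w : List ℕ} (hw : ∀ c ∈ w, c ≤ 1) : subst [0] [1] w = w := by
  induction w with
  | nil => rfl
  | cons c w ih =>
    have h1 := hw c List.mem_cons_self
    have e : subst [0] [1] (c :: w) = subst [0] [1] [c] ++ subst [0] [1] w :=
      subst_append _ _ [c] w
    rw [e, ih fun d hd => hw d (List.mem_cons_of_mem _ hd)]
    obtain rfl | rfl : c = 0 ∨ c = 1 := by omega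
    · rw [subst_singleton_zero]; rfl
    · rw [subst_singleton_one]; rfl

/-- The pairs `(M(0), M(1))` for the composites `M` of the substitutions
`0 ↦ 0, 1 ↦ 10`, and `0 ↦ 01, 1 ↦ 1`, and `0 ↦ 01, 1 ↦ 10`; the constructors compose with one of
them on the right. -/
inductive Reach : List ℕ → List ℕ → Prop
  | base : Reach [0] [1]
  | left {s t : List ℕ} : Reach s t → Reach s (t ++ s)
  | right {s t : List ℕ} : Reach s t → Reach (s ++ t) t
  | both {s t : List ℕ} : Reach s t → Reach (s ++ t) (t ++ s)

lemma Reach.comp {s t s' t' : List ℕ} (h : Reach s t) (h' : Reach s' t') :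
    Reach (subst s t s') (subst s t t') := by
  induction h' with
  | base => rwa [subst_singleton_zero, subst_singleton_one]
  | left _ ih => rw [subst_append]; exact ih.left
  | right _ ih => rw [subst_append]; exact ih.right
  | both _ ih => rw [subst_append, subst_append]; exact ih.both

lemma Reach.head {s t : List ℕ} (h : Reach s t) : (∃ s', s = 0 :: s') ∧ ∃ t', t = 1 :: t' := by
  induction h with
  | base => exact ⟨⟨[], rfl⟩, ⟨[], rfl⟩⟩
  | left _ ih => obtain ⟨⟨s', rfl⟩, ⟨t', rfl⟩⟩ := ih; exact ⟨⟨_, rfl⟩, ⟨_, rfl⟩⟩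
  | right _ ih => obtain ⟨⟨s', rfl⟩, ⟨t', rfl⟩⟩ := ih; exact ⟨⟨_, rfl⟩, ⟨_, rfl⟩⟩
  | both _ ih => obtain ⟨⟨s', rfl⟩, ⟨t', rfl⟩⟩ := ih; exact ⟨⟨_, rfl⟩, ⟨_, rfl⟩⟩

lemma Reach.ne_nil {s t : List ℕ} (h : Reach s t) : s ≠ [] ∧ t ≠ [] := by
  obtain ⟨⟨s', rfl⟩, ⟨t', rfl⟩⟩ := h.head
  simp

lemma Reach.letters {s t : List ℕ} (h : Reach s t) : (∀ c ∈ s, c ≤ 1) ∧ ∀ c ∈ t, c ≤ 1 := by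
  induction h with
  | base => simp
  | left _ ih =>
    exact ⟨ih.1, fun c hc => (List.mem_append.1 hc).elim (ih.2 c) (ih.1 c)⟩
  | right _ ih =>
    exact ⟨fun c hc => (List.mem_append.1 hc).elim (ih.1 c) (ih.2 c), ih.2⟩
  | both _ ih =>
    exact ⟨fun c hc => (List.mem_append.1 hc).elim (ih.1 c) (ih.2 c),
      fun c hc => (List.mem_append.1 hc).elim (ih.2 c) (ih.1 c)⟩

/-- The letters of the upper mechanical word of slope `r`. -/
def upperLetter (r : ℚ) (i : ℕ) : ℕ := (⌈(i : ℚ) * r⌉ - ⌈((i : ℚ) - 1) * r⌉).toNat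

/-- The letters of the lower mechanical word of slope `r`. -/
def lowerLetter (r : ℚ) (i : ℕ) : ℕ := (⌊(i : ℚ) * r⌋ - ⌊((i : ℚ) - 1) * r⌋).toNat

lemma zeroMax_eq (r : ℚ) : zeroMax r = (List.range r.den).map (upperLetter r) := by
  rw [zeroMax]
  simp only [List.bind_eq_flatMap, List.pure_def]
  rw [← List.map_eq_flatMap, List.map_map]
  rfl

lemma oneMin_eq (r : ℚ) : oneMin r = (List.range r.den).map (lowerLetter r) := by
  rw [oneMin]
  simp only [List.bind_eq_flatMap, List.pure_def]
  rw [← List.map_eq_flatMap, List.map_map]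
  rfl

/-- A substitution carries prefixes of one letter sequence to prefixes of another, of lengths
`pos i`, if it does so letter by letter. -/
lemma subst_map_range {s t : List ℕ} {f g pos : ℕ → ℕ} (h0 : pos 0 = 0)
    (h : ∀ i, (List.range (pos (i + 1))).map g =
      (List.range (pos i)).map g ++ if f i = 0 then s else t) (i : ℕ) :
    subst s t ((List.range i).map f) = (List.range (pos i)).map g := by
  induction i with
  | zero => simp [h0, subst]
  | succ i ih =>
    rw [List.range_succ, List.map_append, subst_append, ih, h]
    simp [subst]

lemma map_range_succ (g : ℕ → ℕ) (n : ℕ) :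
    (List.range (n + 1)).map g = (List.range n).map g ++ [g n] := by
  rw [List.range_succ]; simp

lemma map_range_add_two (g : ℕ → ℕ) (n : ℕ) :
    (List.range (n + 2)).map g = (List.range n).map g ++ [g n, g (n + 1)] := by
  rw [List.range_succ, List.range_succ]; simp

lemma ceil_mul_left {r : ℚ} (h0 : 0 < r) {y : ℚ} {m : ℤ} (h1 : (m - 1) * (1 + r) < y * r)
    (h2 : y * r ≤ m * (1 + r)) : ⌈y * (r / (1 + r))⌉ = m := by
  rw [Int.ceil_eq_iff, ← mul_div_assoc, lt_div_iff₀ (by linarith), div_le_iff₀ (by linarith)]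
  exact ⟨h1, h2⟩

lemma floor_mul_left {r : ℚ} (h0 : 0 < r) {y : ℚ} {m : ℤ} (h1 : m * (1 + r) ≤ y * r)
    (h2 : y * r < (m + 1) * (1 + r)) : ⌊y * (r / (1 + r))⌋ = m := by
  rw [Int.floor_eq_iff, ← mul_div_assoc, le_div_iff₀ (by linarith), div_lt_iff₀ (by linarith)]
  exact ⟨h1, h2⟩

lemma ceil_mul_right {r : ℚ} (h0 : r < 1) {y : ℚ} {m : ℤ} (h1 : (m - 1) * (2 - r) < y)
    (h2 : y ≤ m * (2 - r)) : ⌈y * (1 / (2 - r))⌉ = m := by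
  rw [Int.ceil_eq_iff, ← mul_div_assoc, mul_one, lt_div_iff₀ (by linarith),
    div_le_iff₀ (by linarith)]
  exact ⟨h1, h2⟩

lemma floor_mul_right {r : ℚ} (h0 : r < 1) {y : ℚ} {m : ℤ} (h1 : m * (2 - r) ≤ y)
    (h2 : y < (m + 1) * (2 - r)) : ⌊y * (1 / (2 - r))⌋ = m := by
  rw [Int.floor_eq_iff, ← mul_div_assoc, mul_one, le_div_iff₀ (by linarith),
    div_lt_iff₀ (by linarith)]
  exact ⟨h1, h2⟩

/-- The number of `1`s in a prefix of the upper word, and its step. -/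
lemma ceil_step {r : ℚ} (h0 : 0 < r) (h1 : r < 1) (i : ℕ) :
    ∃ m : ℕ, ⌈((i : ℚ) - 1) * r⌉ = m ∧ (m : ℚ) - 1 < (i - 1) * r ∧ ((i : ℚ) - 1) * r ≤ m ∧
      ((⌈(i : ℚ) * r⌉ = m ∧ (i : ℚ) * r ≤ m) ∨ (⌈(i : ℚ) * r⌉ = m + 1 ∧ (m : ℚ) < i * r)) := by
  have hi : (0 : ℚ) ≤ i := Nat.cast_nonneg i
  have hnn : 0 ≤ ⌈((i : ℚ) - 1) * r⌉ := by
    have : -1 < ⌈((i : ℚ) - 1) * r⌉ := by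
      rw [Int.lt_ceil]; push_cast; nlinarith
    omega
  obtain ⟨m, hm⟩ := Int.eq_ofNat_of_zero_le hnn
  have h2 := (Int.ceil_eq_iff.1 hm).1
  have h3 := (Int.ceil_eq_iff.1 hm).2
  push_cast at h2 h3
  refine ⟨m, hm, h2, h3, ?_⟩
  rcases le_or_gt ((i : ℚ) * r) m with h | h
  · left
    refine ⟨Int.ceil_eq_iff.2 ⟨?_, by exact_mod_cast h⟩, h⟩
    push_cast; linarith
  · right
    refine ⟨Int.ceil_eq_iff.2 ⟨?_, ?_⟩, h⟩ <;> push_cast <;> linarith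

/-- The number of `1`s in a prefix of the lower word, and its step. -/
lemma floor_step {r : ℚ} (h0 : 0 < r) (h1 : r < 1) (i : ℕ) :
    ∃ m : ℕ, ⌊((i : ℚ) - 1) * r⌋ = m - 1 ∧ (m : ℚ) - 1 ≤ (i - 1) * r ∧ ((i : ℚ) - 1) * r < m ∧
      ((⌊(i : ℚ) * r⌋ = m - 1 ∧ (i : ℚ) * r < m) ∨ (⌊(i : ℚ) * r⌋ = m ∧ (m : ℚ) ≤ i * r)) := by
  have hi : (0 : ℚ) ≤ i := Nat.cast_nonneg i
  have hnn : 0 ≤ ⌊((i : ℚ) - 1) * r⌋ + 1 := by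
    have : -1 ≤ ⌊((i : ℚ) - 1) * r⌋ := by
      rw [Int.le_floor]; push_cast; nlinarith
    omega
  obtain ⟨m, hm⟩ := Int.eq_ofNat_of_zero_le hnn
  have hm' : ⌊((i : ℚ) - 1) * r⌋ = m - 1 := by omega
  have h2 := (Int.floor_eq_iff.1 hm').1
  have h3 := (Int.floor_eq_iff.1 hm').2
  push_cast at h2 h3
  refine ⟨m, hm', h2, by linarith, ?_⟩
  rcases lt_or_ge ((i : ℚ) * r) m with h | h
  · left
    refine ⟨Int.floor_eq_iff.2 ⟨?_, ?_⟩, h⟩ <;> push_cast <;> linarith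
  · right
    refine ⟨Int.floor_eq_iff.2 ⟨?_, ?_⟩, h⟩ <;> push_cast <;> linarith

lemma upperLetter_left {r : ℚ} (h0 : 0 < r) (h1 : r < 1) (i : ℕ) :
    subst [0] [1, 0] ((List.range i).map (upperLetter r)) =
      (List.range (i + ⌈((i : ℚ) - 1) * r⌉.toNat)).map (upperLetter (r / (1 + r))) := by
  refine subst_map_range (pos := fun i : ℕ => i + ⌈((i : ℚ) - 1) * r⌉.toNat) ?_ (fun i => ?_) i
  · have : ⌈(((0 : ℕ) : ℚ) - 1) * r⌉ = 0 := by
      rw [Int.ceil_eq_iff]; constructor <;> push_cast <;> linarith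
    simp only [this]; rfl
  · obtain ⟨m, hm, h2, h3, h4⟩ := ceil_step h0 h1 i
    have e1 : ((i + 1 : ℕ) : ℚ) - 1 = i := by push_cast; ring
    have f1 : ⌈(((i + m : ℕ) : ℚ) - 1) * (r / (1 + r))⌉ = m := by
      apply ceil_mul_left h0 <;> push_cast <;> linarith
    simp only [e1, hm, Int.toNat_natCast]
    rcases h4 with ⟨h4, h5⟩ | ⟨h4, h5⟩
    · have f2 : ⌈((i + m : ℕ) : ℚ) * (r / (1 + r))⌉ = m := by
        apply ceil_mul_left h0 <;> push_cast <;> linarith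
      rw [h4, Int.toNat_natCast, show i + 1 + m = i + m + 1 by ring, map_range_succ]
      simp only [upperLetter, h4, hm, f1, f2]
      simp
    · have f2 : ⌈((i + m : ℕ) : ℚ) * (r / (1 + r))⌉ = m + 1 := by
        apply ceil_mul_left h0 <;> push_cast <;> linarith
      have f3 : ⌈((i + m + 1 : ℕ) : ℚ) * (r / (1 + r))⌉ = m + 1 := by
        apply ceil_mul_left h0 <;> push_cast <;> linarith
      have e2 : ((i + m + 1 : ℕ) : ℚ) - 1 = (i + m : ℕ) := by push_cast; ring
      rw [h4, show ((m : ℤ) + 1).toNat = m + 1 by omega, show i + 1 + (m + 1) = i + m + 2 by ring,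
        map_range_add_two]
      simp only [upperLetter, h4, hm, f1, f2, f3, e2]
      simp

lemma lowerLetter_left {r : ℚ} (h0 : 0 < r) (h1 : r < 1) (i : ℕ) :
    subst [0] [1, 0] ((List.range i).map (lowerLetter r)) =
      (List.range (i + (⌊((i : ℚ) - 1) * r⌋ + 1).toNat)).map (lowerLetter (r / (1 + r))) := by
  refine subst_map_range (pos := fun i : ℕ => i + (⌊((i : ℚ) - 1) * r⌋ + 1).toNat) ?_
    (fun i => ?_) i
  · have : ⌊(((0 : ℕ) : ℚ) - 1) * r⌋ = -1 := by
      rw [Int.floor_eq_iff]; constructor <;> push_cast <;> linarith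
    simp only [this]; rfl
  · obtain ⟨m, hm, h2, h3, h4⟩ := floor_step h0 h1 i
    have e1 : ((i + 1 : ℕ) : ℚ) - 1 = i := by push_cast; ring
    have f1 : ⌊(((i + m : ℕ) : ℚ) - 1) * (r / (1 + r))⌋ = m - 1 := by
      apply floor_mul_left h0 <;> push_cast <;> linarith
    simp only [e1, hm, sub_add_cancel, Int.toNat_natCast]
    rcases h4 with ⟨h4, h5⟩ | ⟨h4, h5⟩
    · have f2 : ⌊((i + m : ℕ) : ℚ) * (r / (1 + r))⌋ = m - 1 := by
        apply floor_mul_left h0 <;> push_cast <;> linarith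
      rw [h4, sub_add_cancel, Int.toNat_natCast, show i + 1 + m = i + m + 1 by ring,
        map_range_succ]
      simp only [lowerLetter, h4, hm, f1, f2]
      simp
    · have f2 : ⌊((i + m : ℕ) : ℚ) * (r / (1 + r))⌋ = m := by
        apply floor_mul_left h0 <;> push_cast <;> linarith
      have f3 : ⌊((i + m + 1 : ℕ) : ℚ) * (r / (1 + r))⌋ = m := by
        apply floor_mul_left h0 <;> push_cast <;> linarith
      have e2 : ((i + m + 1 : ℕ) : ℚ) - 1 = (i + m : ℕ) := by push_cast; ring
      rw [h4, show ((m : ℤ) + 1).toNat = m + 1 by omega, show i + 1 + (m + 1) = i + m + 2 by ring,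
        map_range_add_two]
      simp only [lowerLetter, h4, hm, f1, f2, f3, e2]
      simp

lemma upperLetter_right {r : ℚ} (h0 : 0 < r) (h1 : r < 1) (i : ℕ) :
    subst [0, 1] [1] ((List.range i).map (upperLetter r)) =
      (List.range (2 * i - ⌈((i : ℚ) - 1) * r⌉).toNat).map (upperLetter (1 / (2 - r))) := by
  refine subst_map_range (pos := fun i : ℕ => (2 * i - ⌈((i : ℚ) - 1) * r⌉).toNat) ?_
    (fun i => ?_) i
  · have : ⌈(((0 : ℕ) : ℚ) - 1) * r⌉ = 0 := by
      rw [Int.ceil_eq_iff]; constructor <;> push_cast <;> linarith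
    simp only [this]; rfl
  · obtain ⟨m, hm, h2, h3, h4⟩ := ceil_step h0 h1 i
    have e1 : ((i + 1 : ℕ) : ℚ) - 1 = i := by push_cast; ring
    have hmi : m ≤ i := by
      have hi : (0 : ℚ) ≤ i := Nat.cast_nonneg i
      have : (m : ℚ) < i + 1 := by nlinarith
      exact Nat.lt_succ_iff.1 (by exact_mod_cast this)
    obtain ⟨j, hj⟩ : ∃ j : ℕ, (2 * i - m : ℤ) = j := ⟨2 * i - m, by omega⟩
    have hjq : (j : ℚ) = 2 * i - m := by
      have : ((2 * i - m : ℤ) : ℚ) = ((j : ℤ) : ℚ) := by rw [hj]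
      push_cast at this; exact this.symm
    have f1 : ⌈((j : ℚ) - 1) * (1 / (2 - r))⌉ = i := by
      apply ceil_mul_right h1 <;> push_cast <;> linarith
    simp only [e1, hm, hj, Int.toNat_natCast]
    rcases h4 with ⟨h4, h5⟩ | ⟨h4, h5⟩
    · have f2 : ⌈(j : ℚ) * (1 / (2 - r))⌉ = i := by
        apply ceil_mul_right h1 <;> push_cast <;> linarith
      have f3 : ⌈((j + 1 : ℕ) : ℚ) * (1 / (2 - r))⌉ = i + 1 := by
        apply ceil_mul_right h1 <;> push_cast <;> linarith
      have e2 : ((j + 1 : ℕ) : ℚ) - 1 = j := by push_cast; ring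
      rw [h4, show (2 * ((i + 1 : ℕ) : ℤ) - m).toNat = j + 2 by push_cast; omega,
        map_range_add_two]
      simp only [upperLetter, h4, hm, f1, f2, f3, e2]
      simp
    · have f2 : ⌈(j : ℚ) * (1 / (2 - r))⌉ = i + 1 := by
        apply ceil_mul_right h1 <;> push_cast <;> linarith
      rw [h4, show (2 * ((i + 1 : ℕ) : ℤ) - (m + 1)).toNat = j + 1 by push_cast; omega,
        map_range_succ]
      simp only [upperLetter, h4, hm, f1, f2]
      simp

lemma lowerLetter_right {r : ℚ} (h0 : 0 < r) (h1 : r < 1) (i : ℕ) :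
    subst [0, 1] [1] ((List.range i).map (lowerLetter r)) =
      (List.range (2 * i - (⌊((i : ℚ) - 1) * r⌋ + 1)).toNat).map (lowerLetter (1 / (2 - r))) := by
  refine subst_map_range (pos := fun i : ℕ => (2 * i - (⌊((i : ℚ) - 1) * r⌋ + 1)).toNat) ?_
    (fun i => ?_) i
  · have : ⌊(((0 : ℕ) : ℚ) - 1) * r⌋ = -1 := by
      rw [Int.floor_eq_iff]; constructor <;> push_cast <;> linarith
    simp only [this]; rfl
  · obtain ⟨m, hm, h2, h3, h4⟩ := floor_step h0 h1 i
    have e1 : ((i + 1 : ℕ) : ℚ) - 1 = i := by push_cast; ring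
    have hmi : m ≤ i + 1 := by
      have hi : (0 : ℚ) ≤ i := Nat.cast_nonneg i
      have : (m : ℚ) < i + 2 := by nlinarith
      exact Nat.lt_succ_iff.1 (by exact_mod_cast this)
    have hm0 : i = 0 → m = 0 := by
      rintro rfl
      have : (m : ℚ) < 1 := by push_cast at h2; linarith
      exact Nat.lt_one_iff.1 (by exact_mod_cast this)
    obtain ⟨j, hj⟩ : ∃ j : ℕ, (2 * i - m : ℤ) = j := ⟨2 * i - m, by omega⟩
    have hjq : (j : ℚ) = 2 * i - m := by
      have : ((2 * i - m : ℤ) : ℚ) = ((j : ℤ) : ℚ) := by rw [hj]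
      push_cast at this; exact this.symm
    have f1 : ⌊((j : ℚ) - 1) * (1 / (2 - r))⌋ = i - 1 := by
      apply floor_mul_right h1 <;> push_cast <;> linarith
    simp only [e1, hm, sub_add_cancel, hj, Int.toNat_natCast]
    rcases h4 with ⟨h4, h5⟩ | ⟨h4, h5⟩
    · have f2 : ⌊(j : ℚ) * (1 / (2 - r))⌋ = i - 1 := by
        apply floor_mul_right h1 <;> push_cast <;> linarith
      have f3 : ⌊((j + 1 : ℕ) : ℚ) * (1 / (2 - r))⌋ = i := by
        apply floor_mul_right h1 <;> push_cast <;> linarith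
      have e2 : ((j + 1 : ℕ) : ℚ) - 1 = j := by push_cast; ring
      rw [h4, sub_add_cancel, show (2 * ((i + 1 : ℕ) : ℤ) - m).toNat = j + 2 by push_cast; omega,
        map_range_add_two]
      simp only [lowerLetter, h4, hm, f1, f2, f3, e2]
      simp
    · have f2 : ⌊(j : ℚ) * (1 / (2 - r))⌋ = i := by
        apply floor_mul_right h1 <;> push_cast <;> linarith
      rw [h4, show (2 * ((i + 1 : ℕ) : ℤ) - (m + 1)).toNat = j + 1 by push_cast; omega,
        map_range_succ]
      simp only [lowerLetter, h4, hm, f1, f2]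
      simp

lemma ceil_den_sub_one {r : ℚ} (h0 : 0 < r) (h1 : r < 1) : ⌈((r.den : ℚ) - 1) * r⌉ = r.num := by
  have := Rat.den_mul_eq_num r
  rw [Int.ceil_eq_iff]
  constructor <;> linarith

lemma floor_den_sub_one {r : ℚ} (h0 : 0 < r) (h1 : r < 1) :
    ⌊((r.den : ℚ) - 1) * r⌋ + 1 = r.num := by
  have := Rat.den_mul_eq_num r
  have : ⌊((r.den : ℚ) - 1) * r⌋ = r.num - 1 := by
    rw [Int.floor_eq_iff]
    push_cast
    constructor <;> linarith
  omega

lemma num_lt_den {r : ℚ} (h1 : r < 1) : r.num < r.den := by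
  have := Rat.den_mul_eq_num r
  have hd : (0 : ℚ) < r.den := by exact_mod_cast r.den_pos
  have h : (r.num : ℚ) < ((r.den : ℤ) : ℚ) := by push_cast; nlinarith
  exact_mod_cast h

lemma den_left {r : ℚ} (h0 : 0 < r) : ((r / (1 + r)).den : ℤ) = r.den + r.num := by
  have hn : 0 < r.num := Rat.num_pos.2 h0
  have hd : (0 : ℚ) < r.den := by exact_mod_cast r.den_pos
  have hm := Rat.den_mul_eq_num r
  have e : r / (1 + r) = (r.num : ℚ) / ((r.den + r.num : ℤ) : ℚ) := by
    push_cast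
    rw [← hm, div_eq_div_iff (by linarith) (by positivity)]
    ring
  rw [e]
  refine Rat.den_div_eq_of_coprime (by positivity) ?_
  rw [← Int.isCoprime_iff_nat_coprime]
  simpa [add_comm] using IsCoprime.add_mul_left_right r.isCoprime_num_den 1

lemma den_right {r : ℚ} (h0 : 0 < r) (h1 : r < 1) :
    ((1 / (2 - r)).den : ℤ) = 2 * r.den - r.num := by
  have hn := num_lt_den h1
  have hd : (0 : ℚ) < r.den := by exact_mod_cast r.den_pos
  have hm := Rat.den_mul_eq_num r
  have e : 1 / (2 - r) = ((r.den : ℤ) : ℚ) / ((2 * r.den - r.num : ℤ) : ℚ) := by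
    push_cast
    rw [← hm, div_eq_div_iff (by linarith) (by nlinarith)]
    ring
  rw [e]
  refine Rat.den_div_eq_of_coprime (by omega) ?_
  rw [← Int.isCoprime_iff_nat_coprime]
  have h := IsCoprime.add_mul_left_right (r.isCoprime_num_den.symm.neg_right) 2
  rwa [show -r.num + (r.den : ℤ) * 2 = 2 * r.den - r.num by ring] at h

/-- `0 ↦ 0, 1 ↦ 10` carries the balanced substitution of slope `r` to that of slope `r / (1 + r)`. -/
lemma subst_balanced_left {r : ℚ} (h0 : 0 < r) (h1 : r < 1) :
    subst [0] [1, 0] (zeroMax r) = zeroMax (r / (1 + r)) ∧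
      subst [0] [1, 0] (oneMin r) = oneMin (r / (1 + r)) := by
  have hn : 0 < r.num := Rat.num_pos.2 h0
  have hd := den_left h0
  rw [zeroMax_eq, zeroMax_eq, oneMin_eq, oneMin_eq, upperLetter_left h0 h1, lowerLetter_left h0 h1,
    ceil_den_sub_one h0 h1, floor_den_sub_one h0 h1,
    show r.den + r.num.toNat = (r / (1 + r)).den by omega]
  exact ⟨rfl, rfl⟩

/-- `0 ↦ 01, 1 ↦ 1` carries the balanced substitution of slope `r` to that of slope `1 / (2 - r)`. -/
lemma subst_balanced_right {r : ℚ} (h0 : 0 < r) (h1 : r < 1) :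
    subst [0, 1] [1] (zeroMax r) = zeroMax (1 / (2 - r)) ∧
      subst [0, 1] [1] (oneMin r) = oneMin (1 / (2 - r)) := by
  have hd := den_right h0 h1
  rw [zeroMax_eq, zeroMax_eq, oneMin_eq, oneMin_eq, upperLetter_right h0 h1,
    lowerLetter_right h0 h1, ceil_den_sub_one h0 h1, floor_den_sub_one h0 h1, ← hd,
    Int.toNat_natCast]
  exact ⟨rfl, rfl⟩

lemma balanced_half : zeroMax (1 / 2) = [0, 1] ∧ oneMin (1 / 2) = [1, 0] := by
  have hd : ((1 : ℚ) / 2).den = 2 := by norm_num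
  have e1 : ⌈-(1 / 2 : ℚ)⌉ = 0 := by rw [Int.ceil_eq_iff]; norm_num
  have e2 : ⌈(1 / 2 : ℚ)⌉ = 1 := by rw [Int.ceil_eq_iff]; norm_num
  have e3 : ⌊-(1 / 2 : ℚ)⌋ = -1 := by rw [Int.floor_eq_iff]; norm_num
  have e4 : ⌊(1 / 2 : ℚ)⌋ = 0 := by rw [Int.floor_eq_iff]; norm_num
  rw [zeroMax_eq, oneMin_eq, hd]
  simp only [one_div] at *
  constructor <;>
  simp [List.range_succ, upperLetter, lowerLetter, e1, e2, e3, e4]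

/-- The substitution with slope `r` is a composite of elementary substitutions ending in
`0 ↦ 01, 1 ↦ 10`: subtractive Euclidean algorithm for the numerator and the denominator. -/
lemma exists_reach_balanced {r : ℚ} (h0 : 0 < r) (h1 : r < 1) :
    ∃ s t, Reach s t ∧ zeroMax r = s ++ t ∧ oneMin r = t ++ s := by
  induction hn : r.den using Nat.strong_induction_on generalizing r with
  | _ n ih =>
    rcases lt_trichotomy r (1 / 2) with h | h | h
    · have hr0 : 0 < r / (1 - r) := div_pos h0 (by linarith)
      have hr1 : r / (1 - r) < 1 := by rw [div_lt_one (by linarith)]; linarith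
      have e : r / (1 - r) / (1 + r / (1 - r)) = r := by
        have : 1 - r ≠ 0 := by linarith
        field_simp; ring
      have hd := den_left hr0
      rw [e] at hd
      have hp := Rat.num_pos.2 hr0
      obtain ⟨s, t, hst, hz, ho⟩ := ih _ (by omega) hr0 hr1 rfl
      have hb := subst_balanced_left hr0 hr1
      rw [e, hz, ho, subst_append, subst_append] at hb
      have hG : Reach [0] [1, 0] := Reach.base.left
      exact ⟨_, _, hG.comp hst, hb.1.symm, hb.2.symm⟩
    · subst h
      exact ⟨[0], [1], Reach.base, balanced_half.1, balanced_half.2⟩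
    · have hr0 : 0 < 2 - 1 / r := by
        have : 1 / r < 2 := by rw [div_lt_iff₀ h0]; linarith
        linarith
      have hr1 : 2 - 1 / r < 1 := by
        have : 1 < 1 / r := by rw [lt_div_iff₀ h0]; linarith
        linarith
      have e : 1 / (2 - (2 - 1 / r)) = r := by
        rw [sub_sub_cancel, one_div_one_div]
      have hd := den_right hr0 hr1
      rw [e] at hd
      have hp := num_lt_den hr1
      obtain ⟨s, t, hst, hz, ho⟩ := ih _ (by omega) hr0 hr1 rfl
      have hb := subst_balanced_right hr0 hr1
      rw [e, hz, ho, subst_append, subst_append] at hb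
      have hG : Reach [0, 1] [1] := Reach.base.right
      exact ⟨_, _, hG.comp hst, hb.1.symm, hb.2.symm⟩

lemma iterSubst_cons (r : ℚ) (rs : List ℚ) (c : ℕ) :
    iterSubst (r :: rs) c = subst (zeroMax r) (oneMin r) (iterSubst rs c) := rfl

lemma exists_reach_of_slopes {rs : List ℚ} (h : ∀ r ∈ rs, 0 < r ∧ r < 1) (hne : rs ≠ []) :
    ∃ s t, Reach s t ∧ iterSubst rs 0 = s ++ t ∧ iterSubst rs 1 = t ++ s := by
  induction rs with
  | nil => exact absurd rfl hne
  | cons r rs ih =>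
    obtain ⟨hr0, hr1⟩ := h r List.mem_cons_self
    obtain ⟨s, t, hst, hz, ho⟩ := exists_reach_balanced hr0 hr1
    rw [iterSubst_cons, iterSubst_cons, hz, ho]
    by_cases hrs : rs = []
    · subst hrs
      exact ⟨s, t, hst, subst_singleton_zero _ _, subst_singleton_one _ _⟩
    · obtain ⟨s', t', hst', hz', ho'⟩ := ih (fun q hq => h q (List.mem_cons_of_mem _ hq)) hrs
      rw [hz', ho', subst_append, subst_append]
      exact ⟨_, _, hst.both.comp hst', rfl, rfl⟩

/-- Every pair of `Reach`, composed on the right with `0 ↦ 01, 1 ↦ 10`, comes from a list of slopes.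
Without this last factor it need not: `0 ↦ 0, 1 ↦ 10` is not a product of substitutions `ρ_r`. -/
lemma Reach.exists_slopes {s t : List ℕ} (h : Reach s t) :
    ∃ rs : List ℚ, (∀ r ∈ rs, 0 < r ∧ r < 1) ∧ iterSubst rs 0 = s ++ t ∧
      iterSubst rs 1 = t ++ s := by
  -- slopes for `M` composed with any right factor; the induction moves the last
  -- elementary factor of `M` into the right factor
  suffices key : ∀ s t, Reach s t → ∀ rs : List ℚ, rs ≠ [] → (∀ r ∈ rs, 0 < r ∧ r < 1) →
      ∃ rs' : List ℚ, rs' ≠ [] ∧ (∀ r ∈ rs', 0 < r ∧ r < 1) ∧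
        ∀ c ≤ 1, iterSubst rs' c = subst s t (iterSubst rs c) by
    obtain ⟨rs, -, hrs, he⟩ := key s t h [1 / 2] (by simp) (by simp; norm_num)
    refine ⟨rs, hrs, ?_, ?_⟩
    · rw [he _ (by norm_num), iterSubst_cons, balanced_half.1, balanced_half.2]
      simp [iterSubst, subst]
    · rw [he _ (by norm_num), iterSubst_cons, balanced_half.1, balanced_half.2]
      simp [iterSubst, subst]
  intro s t h
  induction h with
  | base =>
    intro rs hne hrs
    refine ⟨rs, hne, hrs, fun c hc => (subst_zero_one ?_).symm⟩
    obtain ⟨s, t, hst, h0, h1⟩ := exists_reach_of_slopes hrs hne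
    have hl := hst.both.letters
    obtain rfl | rfl : c = 0 ∨ c = 1 := by omega
    · rw [h0]; exact hl.1
    · rw [h1]; exact hl.2
  | @left s t _ ih =>
    intro rs hne hrs
    obtain ⟨r, rs, rfl⟩ := List.exists_cons_of_ne_nil hne
    obtain ⟨hr0, hr1⟩ := hrs r List.mem_cons_self
    obtain ⟨rs', h1, h2, h3⟩ := ih (r / (1 + r) :: rs) (by simp) (by
      intro q hq
      rcases List.mem_cons.1 hq with rfl | hq
      · exact ⟨div_pos hr0 (by linarith), by rw [div_lt_one (by linarith)]; linarith⟩
      · exact hrs q (List.mem_cons_of_mem _ hq))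
    refine ⟨rs', h1, h2, fun c hc => ?_⟩
    rw [h3 c hc, iterSubst_cons, iterSubst_cons, ← (subst_balanced_left hr0 hr1).1,
      ← (subst_balanced_left hr0 hr1).2, ← subst_subst, subst_subst s t]
    simp [subst]
  | @right s t _ ih =>
    intro rs hne hrs
    obtain ⟨r, rs, rfl⟩ := List.exists_cons_of_ne_nil hne
    obtain ⟨hr0, hr1⟩ := hrs r List.mem_cons_self
    obtain ⟨rs', h1, h2, h3⟩ := ih (1 / (2 - r) :: rs) (by simp) (by
      intro q hq
      rcases List.mem_cons.1 hq with rfl | hq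
      · exact ⟨div_pos one_pos (by linarith), by rw [div_lt_one (by linarith)]; linarith⟩
      · exact hrs q (List.mem_cons_of_mem _ hq))
    refine ⟨rs', h1, h2, fun c hc => ?_⟩
    rw [h3 c hc, iterSubst_cons, iterSubst_cons, ← (subst_balanced_right hr0 hr1).1,
      ← (subst_balanced_right hr0 hr1).2, ← subst_subst, subst_subst s t]
    simp [subst]
  | @both s t _ ih =>
    intro rs hne hrs
    obtain ⟨rs', h1, h2, h3⟩ := ih (1 / 2 :: rs) (by simp) (by
      intro q hq
      rcases List.mem_cons.1 hq with rfl | hq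
      · norm_num
      · exact hrs q hq)
    refine ⟨rs', h1, h2, fun c hc => ?_⟩
    rw [h3 c hc, iterSubst_cons, balanced_half.1, balanced_half.2, subst_subst]
    simp [subst]

/-! ### The Glendinning–Sidorov function in terms of word maps -/

/-- The `n`-th letter of `u v v v ⋯`. -/
def periodicLetter (u v : List ℕ) (n : ℕ) : ℕ :=
  if n < u.length then u.getD n 0 else v.getD ((n - u.length) % v.length) 0

lemma getD_le_one {w : List ℕ} (hw : ∀ c ∈ w, c ≤ 1) (n : ℕ) : w.getD n 0 ≤ 1 := by
  rw [List.getD_eq_getElem?_getD]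
  cases h : w[n]? with
  | none => simp
  | some c => exact hw c (List.mem_of_getElem? h)

lemma periodicLetter_le_one {u v : List ℕ} (hu : ∀ c ∈ u, c ≤ 1) (hv : ∀ c ∈ v, c ≤ 1) (n : ℕ) :
    periodicLetter u v n ≤ 1 := by
  unfold periodicLetter
  split_ifs
  · exact getD_le_one hu _
  · exact getD_le_one hv _

lemma binaryValue_eq_tsum (u v : List ℕ) :
    binaryValue u v = ∑' n, (periodicLetter u v n : ℝ) / 2 ^ (n + 1) := by
  unfold binaryValue periodicLetter
  rfl

lemma periodicLetter_term_le {u v : List ℕ} (hu : ∀ c ∈ u, c ≤ 1) (hv : ∀ c ∈ v, c ≤ 1) (n : ℕ) :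
    (periodicLetter u v n : ℝ) / 2 ^ (n + 1) ≤ (1 / 2) ^ (n + 1) := by
  have : (periodicLetter u v n : ℝ) ≤ 1 := by exact_mod_cast periodicLetter_le_one hu hv n
  rw [one_div_pow]
  gcongr

lemma summable_periodicLetter {u v : List ℕ} (hu : ∀ c ∈ u, c ≤ 1) (hv : ∀ c ∈ v, c ≤ 1) :
    Summable fun n => (periodicLetter u v n : ℝ) / 2 ^ (n + 1) :=
  Summable.of_nonneg_of_le (fun n => by positivity) (periodicLetter_term_le hu hv)
    summable_half_pow_succ

lemma binaryValue_le_one {u v : List ℕ} (hu : ∀ c ∈ u, c ≤ 1) (hv : ∀ c ∈ v, c ≤ 1) :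
    binaryValue u v ≤ 1 := by
  rw [binaryValue_eq_tsum]
  exact ((summable_periodicLetter hu hv).tsum_le_tsum (periodicLetter_term_le hu hv)
    summable_half_pow_succ).trans_eq tsum_half_pow_succ

lemma periodicLetter_self (v : List ℕ) (n : ℕ) : periodicLetter v v n = periodicLetter [] v n := by
  unfold periodicLetter
  split_ifs with h1 h2 h2
  · simp at h2
  · simp [Nat.mod_eq_of_lt h1]
  · simp at h2
  · rw [List.length_nil, Nat.sub_zero, ← Nat.mod_eq_sub_mod (not_lt.1 h1)]

/-- Reading the expansion `u v v v ⋯` from the left. -/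
lemma binaryValue_eq_wordMap {u v : List ℕ} (hu : ∀ c ∈ u, c ≤ 1) (hv : ∀ c ∈ v, c ≤ 1) :
    binaryValue u v = wordMap u (binaryValue v v) := by
  have hself : binaryValue v v = binaryValue [] v := by
    rw [binaryValue_eq_tsum, binaryValue_eq_tsum]
    exact tsum_congr fun n => by rw [periodicLetter_self]
  rw [hself]
  induction u with
  | nil => rfl
  | cons c u ih =>
    rw [wordMap_cons, ← ih fun d hd => hu d (List.mem_cons_of_mem _ hd), binaryValue_eq_tsum,
      binaryValue_eq_tsum, (summable_periodicLetter hu hv).tsum_eq_zero_add, add_div,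
      ← tsum_div_const]
    congr 1
    · simp [periodicLetter]
    · refine tsum_congr fun n => ?_
      have : periodicLetter (c :: u) v (n + 1) = periodicLetter u v n := by
        simp [periodicLetter]
      rw [this, pow_succ 2 (n + 1), div_div]

/-- For `b > 1/2` the inequality `b < χ(a)` is witnessed by a pair `s, t` of `Reach`: it has
`(st)^∞ ≤ a` and `b < ts(st)^∞`. -/
lemma lt_chi_iff {a b : ℝ} (ha : 0 ≤ a) (hb : 1 / 2 < b) :
    b < chi a ↔ ∃ s t, Reach s t ∧ ∃ x, wordMap (s ++ t) x = x ∧ x ≤ a ∧ b < wordMap (t ++ s) x := by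
  have hbase : ∀ c : ℕ, iterSubst [] c = [c] := fun c => rfl
  have h00 : binaryValue [0] [0] = 0 := by
    have h := binaryValue_eq_wordMap (u := [0]) (v := [0]) (by simp) (by simp)
    rw [wordMap_cons, wordMap_nil] at h
    push_cast at h; linarith
  have hbdd : BddAbove {y : ℝ | ∃ rs : List ℚ, (∀ r ∈ rs, 0 < r ∧ r < 1) ∧
      binaryValue (iterSubst rs 0) (iterSubst rs 0) ≤ a ∧
      y = binaryValue (iterSubst rs 1) (iterSubst rs 0)} := by
    refine ⟨1, ?_⟩
    rintro _ ⟨rs, hrs, -, rfl⟩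
    by_cases hne : rs = []
    · subst hne
      exact binaryValue_le_one (by simp [hbase]) (by simp [hbase])
    · obtain ⟨s, t, hst, h0, h1⟩ := exists_reach_of_slopes hrs hne
      rw [h0, h1]
      exact binaryValue_le_one hst.both.letters.2 hst.both.letters.1
  constructor
  · intro h
    have hnonempty : {y : ℝ | ∃ rs : List ℚ, (∀ r ∈ rs, 0 < r ∧ r < 1) ∧
        binaryValue (iterSubst rs 0) (iterSubst rs 0) ≤ a ∧
        y = binaryValue (iterSubst rs 1) (iterSubst rs 0)}.Nonempty :=
      ⟨_, [], by simp, by rw [hbase, h00]; exact ha, rfl⟩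
    obtain ⟨_, ⟨rs, hrs, hle, rfl⟩, hlt⟩ := exists_lt_of_lt_csSup hnonempty h
    by_cases hne : rs = []
    · subst hne
      rw [hbase, hbase, binaryValue_eq_wordMap (by simp) (by simp), h00, wordMap_cons,
        wordMap_nil] at hlt
      push_cast at hlt; linarith
    · obtain ⟨s, t, hst, h0, h1⟩ := exists_reach_of_slopes hrs hne
      have hl := hst.both.letters
      rw [h0] at hle
      rw [h0, h1, binaryValue_eq_wordMap hl.2 hl.1] at hlt
      exact ⟨s, t, hst, _, (binaryValue_eq_wordMap hl.1 hl.1).symm, hle, hlt⟩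
  · rintro ⟨s, t, hst, x, hx, hxa, hbx⟩
    obtain ⟨rs, hrs, h0, h1⟩ := hst.exists_slopes
    have hl := hst.both.letters
    have hxe : x = binaryValue (s ++ t) (s ++ t) :=
      wordMap_fixed_unique hst.both.ne_nil.1 hx (binaryValue_eq_wordMap hl.1 hl.1).symm
    refine lt_of_lt_of_le hbx (le_csSup hbdd ⟨rs, hrs, ?_, ?_⟩)
    · rwa [h0, ← hxe]
    · rw [h0, h1, binaryValue_eq_wordMap hl.2 hl.1, ← hxe]

/-! ### The order of the word maps of a pair -/

lemma Reach.order {s t : List ℕ} (h : Reach s t) : wordMap s 1 ≤ wordMap t 0 := by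
  induction h with
  | base => simp [wordMap]
  | @left s t h ih =>
    rw [wordMap_append]
    exact ih.trans (wordMap_mono _ (wordMap_nonneg _ le_rfl))
  | @right s t h ih =>
    rw [wordMap_append]
    exact (wordMap_mono _ (wordMap_le_one h.letters.2 le_rfl)).trans ih
  | @both s t h ih =>
    rw [wordMap_append, wordMap_append]
    exact (wordMap_mono _ (wordMap_le_one h.letters.2 le_rfl)).trans
      (ih.trans (wordMap_mono _ (wordMap_nonneg _ le_rfl)))

/-- The iterated function system of the word maps of two nonempty `0`-`1` words. -/
def pairIfs (s t : List ℕ) (hs : s ≠ [] ∧ ∀ c ∈ s, c ≤ 1) (ht : t ≠ [] ∧ ∀ c ∈ t, c ≤ 1) : Ifs where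
  c i := wordMap (if i then t else s) 0
  l i := (1 / 2) ^ (if i then t else s).length
  c_nonneg i := wordMap_nonneg _ le_rfl
  l_pos i := by positivity
  l_le i := by
    have : (if i then t else s).length ≠ 0 := by
      split_ifs
      · simpa using ht.1
      · simpa using hs.1
    exact pow_le_of_le_one (by norm_num) (by norm_num) this
  le_one i := by
    have hl : ∀ c ∈ (if i then t else s), c ≤ 1 := by
      split_ifs
      · exact ht.2
      · exact hs.2
    have := wordMap_le_one hl le_rfl
    rwa [wordMap_eq, mul_one] at this

lemma pairIfs_map_false {s t : List ℕ} (hs : s ≠ [] ∧ ∀ c ∈ s, c ≤ 1)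
    (ht : t ≠ [] ∧ ∀ c ∈ t, c ≤ 1) (x : ℝ) : (pairIfs s t hs ht).map false x = wordMap s x := by
  rw [wordMap_eq]; rfl

lemma pairIfs_map_true {s t : List ℕ} (hs : s ≠ [] ∧ ∀ c ∈ s, c ≤ 1)
    (ht : t ≠ [] ∧ ∀ c ∈ t, c ≤ 1) (x : ℝ) : (pairIfs s t hs ht).map true x = wordMap t x := by
  rw [wordMap_eq]; rfl

/-- The iterated function system of a pair of `Reach`. -/
def wordIfs (s t : List ℕ) (h : Reach s t) : Ifs :=
  pairIfs s t ⟨h.ne_nil.1, h.letters.1⟩ ⟨h.ne_nil.2, h.letters.2⟩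

lemma wordIfs_map_false {s t : List ℕ} (h : Reach s t) (x : ℝ) :
    (wordIfs s t h).map false x = wordMap s x :=
  pairIfs_map_false _ _ x

lemma wordIfs_map_true {s t : List ℕ} (h : Reach s t) (x : ℝ) :
    (wordIfs s t h).map true x = wordMap t x :=
  pairIfs_map_true _ _ x

/-! ### Renormalization -/

/-- The tails of `y` that begin with `false` have `F`-values at most `a`, those that begin with
`true` have `F`-values at least `b`. -/
def Admissible (F : Ifs) (a b : ℝ) (y : ℕ → Bool) : Prop :=
  ∀ n, (y n = false → F.code (shift n y) ≤ a) ∧ (y n = true → b ≤ F.code (shift n y))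

/-- If `y` is cut at the places `pos n` into blocks, each of which acts as the map of `F'` given by
its first letter, then the first letters of the blocks form an `F'`-coding. -/
lemma Ifs.code_parse {F F' : Ifs} {y : ℕ → Bool} {pos : ℕ → ℕ}
    (h : ∀ n, F.code (shift (pos n) y) = F'.map (y (pos n)) (F.code (shift (pos (n + 1)) y)))
    (n : ℕ) : F.code (shift (pos n) y) = F'.code (shift n fun m => y (pos m)) :=
  F'.code_unique (fun n => F.code_mem (shift (pos n) y)) h n

lemma Admissible.parse {F F' : Ifs} {a b : ℝ} {y : ℕ → Bool} (hy : Admissible F a b y) {pos : ℕ → ℕ}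
    (h : ∀ n, F.code (shift (pos n) y) = F'.map (y (pos n)) (F.code (shift (pos (n + 1)) y))) :
    ∃ y', Admissible F' a b y' ∧ F.code (shift (pos 0) y) = F'.code y' := by
  refine ⟨fun m => y (pos m), fun n => ?_, by simpa using Ifs.code_parse h 0⟩
  rw [← Ifs.code_parse h n]
  exact hy (pos n)

section

variable {s t : List ℕ} (h : Reach s t)

lemma wordIfs_code_false {y : ℕ → Bool} {n : ℕ} (hn : y n = false) :
    (wordIfs s t h).code (shift n y) = wordMap s ((wordIfs s t h).code (shift (n + 1) y)) := by
  rw [Ifs.code_shift, hn, wordIfs_map_false]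

lemma wordIfs_code_true {y : ℕ → Bool} {n : ℕ} (hn : y n = true) :
    (wordIfs s t h).code (shift n y) = wordMap t ((wordIfs s t h).code (shift (n + 1) y)) := by
  rw [Ifs.code_shift, hn, wordIfs_map_true]

/-- The alternating runs `(01)^j`, and with the roles of the letters exchanged `(10)^j`. -/
lemma wordIfs_code_run {y : ℕ → Bool} {n : ℕ} (c : Bool) (j : ℕ)
    (hr : ∀ l < j, y (n + 2 * l) = c ∧ y (n + 2 * l + 1) = !c) :
    (wordIfs s t h).code (shift n y) =
      (fun x => (wordIfs s t h).map c ((wordIfs s t h).map (!c) x))^[j]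
        ((wordIfs s t h).code (shift (n + 2 * j) y)) := by
  induction j with
  | zero => rfl
  | succ j ih =>
    rw [ih fun l hl => hr l (by omega), Function.iterate_succ_apply, Ifs.code_shift,
      (hr j (by omega)).1, Ifs.code_shift, (hr j (by omega)).2]
    rfl

lemma exists_wordMap_code (y : ℕ → Bool) (p : ℕ) :
    ∃ w, (wordIfs s t h).code y = wordMap w ((wordIfs s t h).code (shift p y)) := by
  induction p with
  | zero => exact ⟨[], rfl⟩
  | succ p ih =>
    obtain ⟨w, hw⟩ := ih
    cases hp : y p
    · exact ⟨w ++ s, by rw [hw, wordMap_append, wordIfs_code_false h hp]⟩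
    · exact ⟨w ++ t, by rw [hw, wordMap_append, wordIfs_code_true h hp]⟩

/-- The value of `(st)^∞`. -/
def altValue : ℝ := (wordIfs _ _ h.both).code fun _ => false

lemma wordMap_altValue : wordMap s (wordMap t (altValue h)) = altValue h := by
  rw [← wordMap_append, ← wordIfs_map_false h.both, altValue]
  exact ((wordIfs _ _ h.both).code_eq fun _ => false).symm

lemma altValue_mem : altValue h ∈ Icc (0 : ℝ) 1 := Ifs.code_mem _ _

lemma Reach.wordMap_zero_pos {s t : List ℕ} (h : Reach s t) : 0 < wordMap t 0 :=
  lt_of_le_of_lt (wordMap_nonneg s le_rfl)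
    ((wordMap_strictMono s zero_lt_one).trans_le h.order)

lemma Reach.wordMap_zero_pos' {s t : List ℕ} (h : Reach s t) :
    0 < wordMap s (wordMap t 0) :=
  lt_of_le_of_lt (wordMap_nonneg s le_rfl) (wordMap_strictMono s h.wordMap_zero_pos)

lemma altValue_pos : 0 < altValue h := by
  rw [← wordMap_altValue]
  exact lt_of_lt_of_le h.wordMap_zero_pos'
    (wordMap_mono _ (wordMap_mono _ (altValue_mem h).1))

/-- No block `011`: renormalization by `0 ↦ 0, 1 ↦ 10`. -/
lemma Admissible.parse_left {a b : ℝ} {y : ℕ → Bool} (hy : Admissible (wordIfs s t h) a b y)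
    (hno : ∀ n, ¬ (y n = false ∧ y (n + 1) = true ∧ y (n + 2) = true)) :
    (∃ c, y = fun _ => c) ∨ ∃ p y', Admissible (wordIfs _ _ h.left) a b y' ∧
      (wordIfs s t h).code (shift p y) = (wordIfs _ _ h.left).code y' := by
  by_cases hf : ∃ p, y p = false
  · right
    obtain ⟨p, hp⟩ := hf
    have h11 : ∀ d, y (p + d) = true → y (p + d + 1) = false := by
      intro d
      induction d with
      | zero => intro h'; rw [add_zero, hp] at h'; exact absurd h' (by simp)
      | succ d ih =>
        intro h1
        by_contra h2
        rw [Bool.not_eq_false] at h2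
        cases h3 : y (p + d)
        · exact hno (p + d) ⟨h3, h1, h2⟩
        · rw [← add_assoc, ih h3] at h1; exact absurd h1 (by simp)
    let pos : ℕ → ℕ := fun n => Nat.rec p (fun _ q => q + if y q then 2 else 1) n
    have hpos : ∀ n, pos (n + 1) = pos n + if y (pos n) then 2 else 1 := fun n => rfl
    have hge : ∀ n, p ≤ pos n := by
      intro n
      induction n with
      | zero => exact le_rfl
      | succ n ih => rw [hpos]; omega
    obtain ⟨y', h1, h2⟩ := hy.parse (F' := wordIfs _ _ h.left) (pos := pos) (fun n => by
      rw [hpos]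
      cases hc : y (pos n)
      · rw [wordIfs_map_false, wordIfs_code_false h hc]; rfl
      · have h3 : y (pos n + 1) = false := by
          have := h11 (pos n - p)
          rw [Nat.add_sub_cancel' (hge n)] at this
          exact this hc
        rw [wordIfs_map_true, wordIfs_code_true h hc, wordIfs_code_false h h3, wordMap_append]
        rfl)
    exact ⟨p, y', h1, h2⟩
  · left
    push Not at hf
    exact ⟨true, funext fun p => by simpa using hf p⟩

/-- No block `100`: renormalization by `0 ↦ 01, 1 ↦ 1`. -/
lemma Admissible.parse_right {a b : ℝ} {y : ℕ → Bool} (hy : Admissible (wordIfs s t h) a b y)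
    (hno : ∀ n, ¬ (y n = true ∧ y (n + 1) = false ∧ y (n + 2) = false)) :
    (∃ c, y = fun _ => c) ∨ ∃ p y', Admissible (wordIfs _ _ h.right) a b y' ∧
      (wordIfs s t h).code (shift p y) = (wordIfs _ _ h.right).code y' := by
  by_cases hf : ∃ p, y p = true
  · right
    obtain ⟨p, hp⟩ := hf
    have h11 : ∀ d, y (p + d) = false → y (p + d + 1) = true := by
      intro d
      induction d with
      | zero => intro h'; rw [add_zero, hp] at h'; exact absurd h' (by simp)
      | succ d ih =>
        intro h1
        by_contra h2
        rw [Bool.not_eq_true] at h2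
        cases h3 : y (p + d)
        · rw [← add_assoc, ih h3] at h1; exact absurd h1 (by simp)
        · exact hno (p + d) ⟨h3, h1, h2⟩
    let pos : ℕ → ℕ := fun n => Nat.rec p (fun _ q => q + if y q then 1 else 2) n
    have hpos : ∀ n, pos (n + 1) = pos n + if y (pos n) then 1 else 2 := fun n => rfl
    have hge : ∀ n, p ≤ pos n := by
      intro n
      induction n with
      | zero => exact le_rfl
      | succ n ih => rw [hpos]; omega
    obtain ⟨y', h1, h2⟩ := hy.parse (F' := wordIfs _ _ h.right) (pos := pos) (fun n => by
      rw [hpos]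
      cases hc : y (pos n)
      · have h3 : y (pos n + 1) = true := by
          have := h11 (pos n - p)
          rw [Nat.add_sub_cancel' (hge n)] at this
          exact this hc
        rw [wordIfs_map_false, wordIfs_code_false h hc, wordIfs_code_true h h3, wordMap_append]
        rfl
      · rw [wordIfs_map_true, wordIfs_code_true h hc]; rfl)
    exact ⟨p, y', h1, h2⟩
  · left
    push Not at hf
    exact ⟨false, funext fun p => by simpa using hf p⟩

end

/-- If no double letter `cc` follows `c̄ c (c c̄)^j`, then the double letters `00` and `11` alternate
and lie an even distance apart. Cut through one of them, the sequence is a product of the blocks `01`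
and `10`. -/
lemma exists_cut {y : ℕ → Bool}
    (hy : ∀ n j c, ¬ (y n = !c ∧ y (n + 1) = c ∧
      (∀ l < j, y (n + 2 + 2 * l) = c ∧ y (n + 2 + 2 * l + 1) = !c) ∧
      y (n + 2 + 2 * j) = c ∧ y (n + 2 + 2 * j + 1) = c)) :
    (∃ c, y = fun _ => c) ∨ ∃ p, ∀ i, y (p + 2 * i + 1) = !y (p + 2 * i) := by
  have bne : ∀ {u v : Bool}, u ≠ v → u = !v := by intro u v; cases u <;> cases v <;> simp
  by_cases hc : ∃ n, y n ≠ y (n + 1)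
  · right
    by_cases hd : ∃ n, y n ≠ y (n + 1) ∧ y (n + 1) = y (n + 2)
    · obtain ⟨n₀, h1, h2⟩ := hd
      refine ⟨n₀ + 2, ?_⟩
      -- the place `n₀ + 2 + 2 * i` lies `2 * j` places after the cut through the last double letter
      have inv : ∀ i, ∃ n j c, n₀ + 2 + 2 * i = n + 2 + 2 * j ∧ y n = !c ∧ y (n + 1) = c ∧
          (∀ l < j, y (n + 2 + 2 * l) = c ∧ y (n + 2 + 2 * l + 1) = !c) ∧
          y (n + 2 + 2 * j) = c := by
        intro i
        induction i with
        | zero => exact ⟨n₀, 0, y (n₀ + 1), rfl, bne h1, rfl, by simp, h2.symm⟩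
        | succ i ih =>
          obtain ⟨n, j, c, he, a1, a2, a3, a4⟩ := ih
          have a5 : y (n + 2 + 2 * j + 1) = !c := bne fun h => hy n j c ⟨a1, a2, a3, a4, h⟩
          by_cases a6 : y (n + 2 + 2 * j + 2) = c
          · refine ⟨n, j + 1, c, by omega, a1, a2, fun l hl => ?_, a6⟩
            rcases Nat.lt_succ_iff_lt_or_eq.1 hl with hl | rfl
            · exact a3 l hl
            · exact ⟨a4, a5⟩
          · exact ⟨n + 2 + 2 * j, 0, !c, by omega, by rw [a4, Bool.not_not], a5, by simp,
              bne a6⟩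
      intro i
      obtain ⟨n, j, c, he, a1, a2, a3, a4⟩ := inv i
      rw [he, a4]
      exact bne fun h => hy n j c ⟨a1, a2, a3, a4, h⟩
    · obtain ⟨n, hn⟩ := hc
      push Not at hd
      have halt : ∀ i, y (n + i) ≠ y (n + i + 1) := by
        intro i
        induction i with
        | zero => exact hn
        | succ i ih => exact hd _ ih
      exact ⟨n, fun i => bne (halt (2 * i)).symm⟩
  · left
    push Not at hc
    refine ⟨y 0, funext fun n => ?_⟩
    induction n with
    | zero => rfl
    | succ n ih => rw [← hc n, ih]

/-- Blocks `01` and `10`: renormalization by `0 ↦ 01, 1 ↦ 10`. -/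
lemma Admissible.parse_both {s t : List ℕ} (h : Reach s t) {a b : ℝ} {y : ℕ → Bool}
    (hy : Admissible (wordIfs s t h) a b y) {p : ℕ}
    (hp : ∀ i, y (p + 2 * i + 1) = !y (p + 2 * i)) :
    ∃ y', Admissible (wordIfs _ _ h.both) a b y' ∧
      (wordIfs s t h).code (shift p y) = (wordIfs _ _ h.both).code y' := by
  refine hy.parse (F' := wordIfs _ _ h.both) (pos := fun n => p + 2 * n) (fun n => ?_)
  have h1 := hp n
  cases hc : y (p + 2 * n)
  · rw [hc] at h1
    rw [wordIfs_map_false, wordIfs_code_false h hc, wordIfs_code_true h h1, wordMap_append]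
    rfl
  · rw [hc] at h1
    rw [wordIfs_map_true, wordIfs_code_true h hc, wordIfs_code_false h h1, wordMap_append]
    rfl

lemma Reach.left_iterate {s t : List ℕ} (h : Reach s t) (n : ℕ) :
    Reach s (t ++ (List.replicate n s).flatten) := by
  induction n with
  | zero => simpa
  | succ n ih =>
    rw [List.replicate_succ', List.flatten_append, ← List.append_assoc]
    simpa using ih.left

lemma wordMap_replicate (w : List ℕ) (n : ℕ) (x : ℝ) :
    wordMap (List.replicate n w).flatten x = (wordMap w)^[n] x := by
  induction n with
  | zero => rfl
  | succ n ih =>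
    rw [List.replicate_succ, List.flatten_cons, wordMap_append, ih, Function.iterate_succ_apply']

/-- No pair of `Reach` witnesses `b < χ(a)`. -/
def NoWitness (a b : ℝ) : Prop :=
  ¬ ∃ s t, Reach s t ∧ ∃ x, wordMap (s ++ t) x = x ∧ x ≤ a ∧ b < wordMap (t ++ s) x

lemma NoWitness.le {a b : ℝ} (hno : NoWitness a b) {s t : List ℕ} (h : Reach s t)
    (ha : altValue h ≤ a) : wordMap t (wordMap s (altValue h)) ≤ b := by
  by_contra hb
  refine hno ⟨s, t, h, altValue h, ?_, ha, ?_⟩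
  · rw [wordMap_append, wordMap_altValue]
  · rw [wordMap_append]; exact not_le.1 hb

/-- The pairs `s t, t (s t)^n` bound `a` by values that tend to `s t (t s)^∞` from above as `n` grows. -/
lemma NoWitness.lt_of_le {a b : ℝ} (hno : NoWitness a b) {s t : List ℕ} (h : Reach s t)
    (hb : b ≤ wordMap t (altValue h)) (n : ℕ) :
    a < wordMap s (wordMap t ((fun x => wordMap t (wordMap s x))^[n] (wordMap t (wordMap t 0)))) := by
  have hv := h.right.left_iterate n
  set P := altValue h with hP
  set x := altValue hv with hx
  have hx1 := wordMap_altValue hv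
  rw [← hx] at hx1
  have hxm := altValue_mem hv
  rw [← hx] at hxm
  have hst : wordMap (s ++ t) = fun x => wordMap s (wordMap t x) := funext (wordMap_append s t)
  have hcomm : ∀ z, wordMap t ((fun x => wordMap s (wordMap t x))^[n] z) =
      (fun x => wordMap t (wordMap s x))^[n] (wordMap t z) :=
    fun z => (Function.Semiconj.iterate_right (f := wordMap t)
      (ga := fun x => wordMap s (wordMap t x)) (gb := fun x => wordMap t (wordMap s x))
      (fun _ => rfl) n) z
  rw [wordMap_append, wordMap_append, wordMap_replicate, hst, hcomm] at hx1
  have hlow : x ≤ wordMap t 0 := by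
    rw [← hx1]
    refine le_trans (wordMap_mono s ?_) h.order
    rw [← hcomm, ← hst, ← wordMap_replicate, ← wordMap_append t (List.flatten _)]
    exact wordMap_le_one h.letters.2 (wordMap_le_one hv.letters.2 hxm.2)
  have hiter : StrictMono ((fun x => wordMap t (wordMap s x))^[n]) :=
    ((wordMap_strictMono t).comp (wordMap_strictMono s)).iterate n
  have hax : a < x := by
    by_contra hax
    have h1 := hno.le hv (not_lt.1 hax)
    rw [← hx, wordMap_append, wordMap_append, wordMap_replicate, hst, hcomm] at h1
    have h2 : P < wordMap t ((fun x => wordMap s (wordMap t x))^[n] x) := by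
      have hPs : P ≤ wordMap t 0 := by
        rw [hP, ← wordMap_altValue]
        exact (wordMap_mono s (wordMap_le_one h.letters.2 (altValue_mem h).2)).trans h.order
      refine hPs.trans_lt (wordMap_strictMono t ?_)
      rw [← hst, ← wordMap_replicate]
      exact (wordMap_nonneg _ le_rfl).trans_lt (wordMap_strictMono _ (altValue_pos hv))
    have h3 : wordMap t P = (fun x => wordMap t (wordMap s x))^[n] (wordMap t
        (wordMap s (wordMap t P))) := by
      have hfix : (fun x => wordMap s (wordMap t x)) P = P := wordMap_altValue h
      rw [← hcomm]
      change wordMap t P = wordMap t ((fun x => wordMap s (wordMap t x))^[n]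
        ((fun x => wordMap s (wordMap t x)) P))
      rw [hfix, Function.iterate_fixed hfix]
    have h5 : P < x := by
      have := wordMap_strictMono s (wordMap_strictMono t h2)
      rwa [hP, wordMap_altValue, hcomm, hx1] at this
    have h4 := hiter (wordMap_strictMono t (wordMap_strictMono s (wordMap_strictMono t h5)))
    rw [← h3] at h4
    linarith
  refine hax.trans_le ?_
  conv_lhs => rw [← hx1]
  exact wordMap_mono s (wordMap_mono t (hiter.monotone (wordMap_mono t hlow)))

/-- One step of renormalization. Which of the three elementary substitutions applies depends on the
position of `(st)^∞` relative to `a` and of `(ts)^∞` relative to `b`. -/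
lemma NoWitness.step {a b : ℝ} (hno : NoWitness a b) {s t : List ℕ} (h : Reach s t) :
    ∃ s' t', ∃ h' : Reach s' t', s.length + t.length < s'.length + t'.length ∧
      ∀ y, Admissible (wordIfs s t h) a b y → (∃ c, y = fun _ => c) ∨
        ∃ p y', Admissible (wordIfs s' t' h') a b y' ∧
          (wordIfs s t h).code (shift p y) = (wordIfs s' t' h').code y' := by
  have hs : 0 < s.length := List.length_pos_iff.2 h.ne_nil.1
  have ht : 0 < t.length := List.length_pos_iff.2 h.ne_nil.2
  have hmem := fun y => (wordIfs s t h).code_mem y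
  have hPQ := wordMap_altValue h
  set P := altValue h with hP
  have hP1 := altValue_mem h
  have hP0 := altValue_pos h
  rw [← hP] at hP1 hP0
  have hQ1 : wordMap t P ≤ 1 := wordMap_le_one h.letters.2 hP1.2
  rcases lt_or_ge a P with haP | haP
  · refine ⟨_, _, h.left, by simp; omega, fun y hy => hy.parse_left h ?_⟩
    rintro n ⟨h0, h1, h2⟩
    have h3 := (hy n).1 h0
    rw [wordIfs_code_false h h0, wordIfs_code_true h h1, wordIfs_code_true h h2] at h3
    have h4 : wordMap s (wordMap t P) ≤ wordMap s (wordMap t (wordMap t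
        ((wordIfs s t h).code (shift (n + 2 + 1) y)))) := by
      refine wordMap_mono s (wordMap_mono t ?_)
      rw [← hPQ]
      exact (wordMap_mono s hQ1).trans (h.order.trans (wordMap_mono t (hmem _).1))
    rw [hPQ] at h4
    linarith
  have hbP := hno.le h haP
  rw [← hP] at hbP
  rcases lt_or_ge (wordMap t P) b with hQb | hQb
  · refine ⟨_, _, h.right, by simp; omega, fun y hy => hy.parse_right h ?_⟩
    rintro n ⟨h0, h1, h2⟩
    have h3 := (hy n).2 h0
    rw [wordIfs_code_true h h0, wordIfs_code_false h h1, wordIfs_code_false h h2] at h3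
    have h4 : wordMap t (wordMap s (wordMap s ((wordIfs s t h).code (shift (n + 2 + 1) y)))) ≤
        wordMap t (wordMap s (wordMap t P)) :=
      wordMap_mono t (wordMap_mono s ((wordMap_mono s (hmem _).2).trans
        (h.order.trans (wordMap_mono t hP1.1))))
    rw [hPQ] at h4
    linarith
  · refine ⟨_, _, h.both, by simp; omega, fun y hy => ?_⟩
    refine (exists_cut ?_).imp_right fun ⟨p, hp⟩ => ⟨p, hy.parse_both h hp⟩
    rintro n j c ⟨h0, h1, h2, h3, h4⟩
    cases c
    · have h5 := (hy n).2 h0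
      rw [wordIfs_code_true h h0, wordIfs_code_false h h1, wordIfs_code_run h false j h2,
        wordIfs_code_false h h3, wordIfs_code_false h h4] at h5
      simp only [Bool.not_false, wordIfs_map_false, wordIfs_map_true] at h5
      have hiter : StrictMono ((fun x => wordMap s (wordMap t x))^[j]) :=
        ((wordMap_strictMono s).comp (wordMap_strictMono t)).iterate j
      have h6 : wordMap s (wordMap s ((wordIfs s t h).code (shift (n + 2 + 2 * j + 1 + 1) y))) <
          P := by
        conv_rhs => rw [← hPQ]
        exact wordMap_strictMono s (((wordMap_mono s (hmem _).2).trans h.order).trans_lt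
          (wordMap_strictMono t hP0))
      have h7 := wordMap_strictMono t (wordMap_strictMono s (hiter h6))
      rw [Function.iterate_fixed (f := fun x => wordMap s (wordMap t x)) hPQ] at h7
      linarith
    · have h5 := (hy n).1 h0
      rw [wordIfs_code_false h h0, wordIfs_code_true h h1, wordIfs_code_run h true j h2,
        wordIfs_code_true h h3, wordIfs_code_true h h4] at h5
      simp only [Bool.not_true, wordIfs_map_false, wordIfs_map_true] at h5
      have hiter : Monotone ((fun x => wordMap t (wordMap s x))^[j]) :=
        ((wordMap_mono t).comp (wordMap_mono s)).iterate j
      have h6 := hno.lt_of_le h hQb j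
      have h7 := wordMap_mono s (wordMap_mono t (hiter (wordMap_mono t
        (wordMap_mono t (hmem (shift (n + 2 + 2 * j + 1 + 1) y)).1))))
      linarith

lemma wordIfs_base : wordIfs [0] [1] Reach.base = digitIfs 2 le_rfl := by
  ext i
  · cases i <;> simp [wordIfs, pairIfs, digitIfs, wordMap]; norm_num
  · cases i <;> simp [wordIfs, pairIfs, digitIfs]

/-- Up to a countable set the survivors consist of images of limit sets of pairs of arbitrarily long
words. -/
lemma NoWitness.exists_cover {a b : ℝ} (hno : NoWitness a b) (ha : a < 1 / 2) (hb : 1 / 2 < b)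
    (m : ℕ) : ∃ s t, ∃ h : Reach s t, m ≤ s.length + t.length ∧ ∃ E : Set ℝ, E.Countable ∧
      survivorSet 2 a b ⊆ E ∪ ⋃ w : List ℕ, wordMap w ''
        ((wordIfs s t h).code '' {y | Admissible (wordIfs s t h) a b y}) := by
  induction m with
  | zero =>
    refine ⟨_, _, Reach.base, by simp, ∅, countable_empty, fun x hx => ?_⟩
    obtain ⟨e, rfl, he⟩ := exists_code_of_mem_survivorSet (k := 2) le_rfl (by simpa using ha)
      (lt_of_eq_of_lt (by norm_num) hb) hx
    rw [wordIfs_base]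
    exact Or.inr (mem_iUnion.2 ⟨[], _, ⟨e, he, rfl⟩, rfl⟩)
  | succ m ih =>
    obtain ⟨s, t, h, hm, E, hE, hsub⟩ := ih
    obtain ⟨s', t', h', hlt, hstep⟩ := hno.step h
    refine ⟨s', t', h', by omega, E ∪ ⋃ w : List ℕ, wordMap w ''
      range fun c : Bool => (wordIfs s t h).code fun _ => c, ?_, fun x hx => ?_⟩
    · exact hE.union (countable_iUnion fun w => (countable_range _).image _)
    · rcases hsub hx with hx | hx
      · exact Or.inl (Or.inl hx)
      · obtain ⟨w, _, ⟨y, hy, rfl⟩, rfl⟩ := mem_iUnion.1 hx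
        rcases hstep y hy with ⟨c, rfl⟩ | ⟨p, y', hy', he⟩
        · exact Or.inl (Or.inr (mem_iUnion.2 ⟨w, _, ⟨c, rfl⟩, rfl⟩))
        · obtain ⟨u, hu⟩ := exists_wordMap_code h y p
          refine Or.inr (mem_iUnion.2 ⟨w ++ u, _, ⟨y', hy', rfl⟩, ?_⟩)
          rw [wordMap_append, hu, he]

lemma wordMap_lipschitz (w : List ℕ) : LipschitzWith 1 (wordMap w) := by
  refine LipschitzWith.of_dist_le_mul fun x y => ?_
  rw [wordMap_eq w x, wordMap_eq w y, Real.dist_eq, Real.dist_eq, add_sub_add_left_eq_sub,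
    ← mul_sub, abs_mul, abs_of_pos (by positivity), NNReal.coe_one]
  exact mul_le_mul_of_nonneg_right (pow_le_one₀ (by norm_num) (by norm_num)) (abs_nonneg _)

lemma NoWitness.survivorDim_eq_zero {a b : ℝ} (hno : NoWitness a b) (ha : a < 1 / 2)
    (hb : 1 / 2 < b) : survivorDim 2 a b = 0 := by
  by_contra hne
  obtain ⟨d, hd0, hd⟩ := ENNReal.lt_iff_exists_nnreal_btwn.1 (pos_iff_ne_zero.2 hne)
  have hdpos : (0 : ℝ) < d := by exact_mod_cast hd0
  set q : ℝ := (1 / 2) ^ (d : ℝ) with hq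
  have hq0 : 0 < q := by positivity
  have hq1 : q < 1 := Real.rpow_lt_one (by norm_num) (by norm_num) hdpos
  obtain ⟨M, hM⟩ := exists_pow_lt_of_lt_one (sub_pos.2 hq1) hq1
  obtain ⟨s, t, h, hm, E, hE, hsub⟩ := hno.exists_cover ha hb (2 * M)
  have hpow : ∀ n : ℕ, ((1 / 2 : ℝ) ^ n) ^ (d : ℝ) = q ^ n := by
    intro n
    rw [hq, ← Real.rpow_natCast, ← Real.rpow_mul (by norm_num), mul_comm,
      Real.rpow_mul (by norm_num), Real.rpow_natCast]
  have hs : 0 < s.length := List.length_pos_iff.2 h.ne_nil.1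
  have ht : 0 < t.length := List.length_pos_iff.2 h.ne_nil.2
  have hle : ∀ {i j : ℕ}, i ≤ j → q ^ j ≤ q ^ i :=
    fun hij => pow_le_pow_of_le_one hq0.le hq1.le hij
  have hdim := (wordIfs s t h).dimH_range_code_le (d := d) (by
    have e1 : (wordIfs s t h).l false = (1 / 2) ^ s.length := rfl
    have e2 : (wordIfs s t h).l true = (1 / 2) ^ t.length := rfl
    rw [e1, e2, hpow, hpow]
    have hs1 : q ^ s.length ≤ q ^ 1 := hle hs
    have ht1 : q ^ t.length ≤ q ^ 1 := hle ht
    rw [pow_one] at hs1 ht1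
    rcases le_total M s.length with hMs | hMs
    · linarith [hle hMs]
    · linarith [hle (by omega : M ≤ t.length)])
  have : survivorDim 2 a b ≤ d := by
    refine (dimH_mono hsub).trans ?_
    rw [dimH_union, dimH_countable hE, dimH_iUnion]
    refine max_le zero_le (iSup_le fun w => ?_)
    exact ((wordMap_lipschitz w).dimH_image_le _).trans
      ((dimH_mono (image_subset_range _ _)).trans hdim)
  exact absurd hd (not_lt.2 this)

/-! ### Survivor sets of positive dimension -/

lemma suffix_append_cons {w l r : List ℕ} {c : ℕ} (h : w <:+ l ++ (c :: r)) :
    w <:+ r ∨ ∃ w', w' <:+ l ∧ w = w' ++ (c :: r) := by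
  obtain ⟨u, hu⟩ := h
  rcases List.append_eq_append_iff.1 hu with ⟨w', h1, h2⟩ | ⟨w', h1, h2⟩
  · exact Or.inr ⟨w', ⟨u, h1.symm⟩, h2⟩
  · cases w' with
    | nil => exact Or.inr ⟨[], List.nil_suffix, by simpa using h2.symm⟩
    | cons d w' =>
      rw [List.cons_append, List.cons.injEq] at h2
      exact Or.inl ⟨w', h2.2.symm⟩

/-- Bounds for the tails that begin inside a block. Let `s = 0 s'` and `t = 1 t'`. If the tails of a
sequence of the blocks `s` and `t` that begin with a block have values in `[U, V]`, then all its tails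
have values between `t' U` and `s' V`. The side conditions hold if `U` and `V` are themselves values of
sequences of blocks, `U` of one that begins with `s` and `V` of one that begins with `t`. -/
lemma Reach.suffix_bounds {s t : List ℕ} (h : Reach s t) {U Z V : ℝ} (hU0 : 0 ≤ U) (hV1 : V ≤ 1)
    (hU : wordMap s U ≤ U) (hUZ : U ≤ Z) (hZV : Z ≤ V) (hV : V ≤ wordMap t V)
    (hU1 : U ≤ wordMap s 1) (hV0 : wordMap t 0 ≤ V) {w : List ℕ}
    (hw : w <:+ s.tail ∨ w <:+ t.tail) :
    wordMap t.tail U ≤ wordMap w Z ∧ wordMap w Z ≤ wordMap s.tail V := by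
  induction h generalizing U Z V w with
  | base =>
    have : w = [] := by simpa using hw
    subst this
    exact ⟨hUZ, hZV⟩
  | @left s t h ih =>
    obtain ⟨⟨s', rfl⟩, ⟨t', rfl⟩⟩ := h.head
    have hord := h.order
    simp only [wordMap_append] at *
    simp only [List.cons_append, List.tail_cons, wordMap_append] at *
    set f := wordMap (0 :: s')
    set g := wordMap (1 :: t')
    have hf : Monotone f := wordMap_mono _
    have hg : Monotone g := wordMap_mono _
    have hf0 : 0 ≤ f 0 := wordMap_nonneg _ le_rfl
    have hfV : f V ≤ V := (hf hV1).trans (hord.trans ((hg hf0).trans hV0))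
    have key := fun {Z' : ℝ} (h1 : f U ≤ Z') (h2 : Z' ≤ V) {w : List ℕ} hw =>
      ih (U := f U) (Z := Z') (V := V) (w := w) (wordMap_nonneg _ hU0) hV1 (hf hU) h1 h2
        (hV.trans (hg hfV)) (hf (hUZ.trans (hZV.trans hV1))) ((hg hf0).trans hV0) hw
    rcases hw with hw | hw
    · exact key (hU.trans hUZ) hZV (Or.inl hw)
    · rcases suffix_append_cons hw with hw | ⟨w', hw', rfl⟩
      · exact key (hU.trans hUZ) hZV (Or.inl hw)
      · rw [wordMap_append]
        exact key (hf hUZ) ((hf hZV).trans hfV) (Or.inr hw')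
  | @right s t h ih =>
    obtain ⟨⟨s', rfl⟩, ⟨t', rfl⟩⟩ := h.head
    have hord := h.order
    have hg1 : wordMap (1 :: t') 1 ≤ 1 := wordMap_le_one h.letters.2 le_rfl
    simp only [wordMap_append] at *
    simp only [List.cons_append, List.tail_cons, wordMap_append] at *
    have hgV : wordMap (1 :: t') V ≤ 1 := wordMap_le_one h.letters.2 hV1
    set f := wordMap (0 :: s')
    set g := wordMap (1 :: t')
    have hf : Monotone f := wordMap_mono _
    have hg : Monotone g := wordMap_mono _
    have hgU : U ≤ g U := hU1.trans ((hf hg1).trans (hord.trans (hg hU0)))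
    have key := fun {Z' : ℝ} (h1 : U ≤ Z') (h2 : Z' ≤ g V) {w : List ℕ} hw =>
      ih (U := U) (Z := Z') (V := g V) (w := w) hU0 hgV ((hf hgU).trans hU) h1 h2 (hg hV)
        (hU1.trans (hf hg1)) (hg (hU0.trans (hUZ.trans hZV))) hw
    rcases hw with hw | hw
    · rcases suffix_append_cons hw with hw | ⟨w', hw', rfl⟩
      · exact key hUZ (hZV.trans hV) (Or.inr hw)
      · rw [wordMap_append]
        exact key (hgU.trans (hg hUZ)) (hg hZV) (Or.inl hw')
    · exact key hUZ (hZV.trans hV) (Or.inr hw)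
  | @both s t h ih =>
    obtain ⟨⟨s', rfl⟩, ⟨t', rfl⟩⟩ := h.head
    have hord := h.order
    have hg1 : wordMap (1 :: t') 1 ≤ 1 := wordMap_le_one h.letters.2 le_rfl
    simp only [wordMap_append] at *
    simp only [List.cons_append, List.tail_cons, wordMap_append] at *
    have hgV1 : wordMap (1 :: t') V ≤ 1 := wordMap_le_one h.letters.2 hV1
    set f := wordMap (0 :: s')
    set g := wordMap (1 :: t')
    have hf : Monotone f := wordMap_mono _
    have hg : Monotone g := wordMap_mono _
    have hf0 : 0 ≤ f 0 := wordMap_nonneg _ le_rfl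
    have hU1' : U ≤ 1 := hUZ.trans (hZV.trans hV1)
    have hV0' : 0 ≤ V := hU0.trans (hUZ.trans hZV)
    have hgU : U ≤ g U := hU1.trans ((hf hg1).trans (hord.trans (hg hU0)))
    have hfV : f V ≤ V := (hf hV1).trans (hord.trans ((hg hf0).trans hV0))
    have hfU : f U ≤ U := (hf hgU).trans hU
    have hgV : V ≤ g V := hV.trans (hg hfV)
    have key := fun {Z' : ℝ} (h1 : f U ≤ Z') (h2 : Z' ≤ g V) {w : List ℕ} hw =>
      ih (U := f U) (Z := Z') (V := g V) (w := w) (wordMap_nonneg _ hU0) hgV1 (hf hfU) h1 h2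
        (hg hgV) (hf hU1') (hg hV0') hw
    rcases hw with hw | hw
    · rcases suffix_append_cons hw with hw | ⟨w', hw', rfl⟩
      · exact key (hfU.trans hUZ) (hZV.trans hgV) (Or.inr hw)
      · rw [wordMap_append]
        exact key (hfU.trans (hgU.trans (hg hUZ))) (hg hZV) (Or.inl hw')
    · rcases suffix_append_cons hw with hw | ⟨w', hw', rfl⟩
      · exact key (hfU.trans hUZ) (hZV.trans hgV) (Or.inl hw)
      · rw [wordMap_append]
        exact key (hf hUZ) ((hf hZV).trans (hfV.trans hgV)) (Or.inr hw')

lemma dimH_range_digitIfs_two : dimH (range (digitIfs 2 le_rfl).code) = 1 := by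
  classical
  have hsub : Ico (0 : ℝ) 1 ⊆ range (digitIfs 2 le_rfl).code := by
    intro x hx
    have hmem := iterate_expandingMap_mem 2 hx
    let e : ℕ → Bool := fun n => decide (1 / 2 ≤ (expandingMap 2)^[n] x)
    have hcode := (digitIfs 2 le_rfl).code_unique (e := e) (u := fun n => (expandingMap 2)^[n] x)
      (fun n => Ico_subset_Icc_self (hmem n)) (fun n => by
        have hm := hmem n
        simp only [Function.iterate_succ_apply']
        set y := (expandingMap 2)^[n] x with hy
        cases hn : e n
        · have h1 : y < 1 / 2 := by simpa [e, ← hy] using hn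
          rw [digitIfs_map_false, expandingMap, Int.fract_eq_self.2]
          · push_cast; ring
          · push_cast; constructor <;> linarith [hm.1]
        · have h1 : 1 / 2 ≤ y := by simpa [e, ← hy] using hn
          have h2 : Int.fract (((2 : ℕ) : ℝ) * y) = 2 * y - 1 := by
            rw [Int.fract_eq_iff]
            exact ⟨by linarith, by linarith [hm.2], 1, by push_cast; ring⟩
          rw [digitIfs_map_true, expandingMap, h2]
          push_cast; ring) 0
    exact ⟨e, by simpa using hcode.symm⟩
  apply le_antisymm
  · exact (dimH_mono (subset_univ _)).trans_eq Real.dimH_univ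
  · refine le_trans ?_ (dimH_mono hsub)
    rw [Real.dimH_of_nonempty_interior (by simp)]
    simp

/-- A limit set whose two parts lie apart has positive dimension. -/
lemma Ifs.dimH_range_code_pos (F : Ifs) {δ : ℝ} (hδ : 0 < δ)
    (h : ∀ e e', e 0 = false → e' 0 = true → δ ≤ |F.code e - F.code e'|) :
    0 < dimH (range F.code) := by
  set lam : ℝ := min (F.l false) (F.l true) with hlam
  have hlam0 : 0 < lam := lt_min (F.l_pos _) (F.l_pos _)
  have hlam1 : lam < 1 := (min_le_left _ _).trans_lt ((F.l_le _).trans_lt (by norm_num))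
  have hll : ∀ i, lam ≤ F.l i := by
    intro i; cases i
    · exact min_le_left _ _
    · exact min_le_right _ _
  have hr : 0 < Real.logb lam (1 / 2) :=
    Real.logb_pos_of_base_lt_one hlam0 hlam1 (by norm_num) (by norm_num)
  have key := dimH_image_le_of_separated (S := univ) (F := F.code)
    (H := (digitIfs 2 le_rfl).code) (δ := δ) (lam := lam) hδ hlam0 hr
    (fun e _ e' _ n hn h0 h1 => by
      rw [F.code_sub n hn, abs_mul, abs_of_nonneg (F.prod_nonneg _ _), mul_comm]
      have h2 : lam ^ n ≤ ∏ i ∈ Finset.range n, F.l (e i) := by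
        calc lam ^ n = ∏ _i ∈ Finset.range n, lam := by simp
          _ ≤ _ := Finset.prod_le_prod (fun _ _ => hlam0.le) fun _ _ => hll _
      have h3 := h (shift n e) (shift n e') (by simpa using h0) (by simpa using h1)
      exact mul_le_mul h2 h3 hδ.le (F.prod_nonneg _ _))
    (fun e _ e' _ n hn => by
      rw [Real.rpow_logb hlam0 hlam1.ne (by norm_num)]
      refine ((digitIfs 2 le_rfl).abs_code_sub_le hn).trans_eq ?_
      simp [digitIfs])
  rw [image_univ, image_univ, dimH_range_digitIfs_two] at key
  by_contra h0
  rw [not_lt, nonpos_iff_eq_zero] at h0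
  rw [h0, ENNReal.zero_div] at key
  exact absurd key (by simp)

/-- If `(st)^∞ ≤ a` and `b < ts(st)^∞`, then for large `n` all sequences of the blocks `s(st)^n` and
`s(st)^(n+1)` survive. -/
lemma Reach.survivorDim_pos {s t : List ℕ} (h : Reach s t) {a b : ℝ} (ha : altValue h ≤ a)
    (hb : b < wordMap t (wordMap s (altValue h))) : 0 < survivorDim 2 a b := by
  obtain ⟨⟨s', hs'⟩, ⟨t', ht'⟩⟩ := h.head
  have hfix := wordMap_altValue h
  have hPm := altValue_mem h
  set P := altValue h
  set f := wordMap s with hfdef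
  set g := wordMap t with hgdef
  set φ : ℝ → ℝ := fun x => f (g x) with hφ
  have hf : StrictMono f := wordMap_strictMono _
  have hg : StrictMono g := wordMap_strictMono _
  have hφm : StrictMono φ := hf.comp hg
  have hord : f 1 ≤ g 0 := h.order
  have hst : wordMap (s ++ t) = φ := funext (wordMap_append s t)
  have hφP : φ P = P := hfix
  have hf01 : ∀ {x}, 0 ≤ x → 0 ≤ f x := fun hx => wordMap_nonneg _ hx
  have hg01 : ∀ {x}, 0 ≤ x → 0 ≤ g x := fun hx => wordMap_nonneg _ hx
  have hf1 : ∀ {x}, x ≤ 1 → f x ≤ 1 := fun hx => wordMap_le_one h.letters.1 hx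
  have hg1 : ∀ {x}, x ≤ 1 → g x ≤ 1 := fun hx => wordMap_le_one h.letters.2 hx
  have hPf : P ≤ f 1 := by rw [← hφP]; exact hf.monotone (hg1 hPm.2)
  have hPg : P ≤ g P := hPf.trans (hord.trans (hg.monotone hPm.1))
  have hP1 : P < 1 := (hPf.trans hord).trans_lt ((hg zero_lt_one).trans_le (hg1 le_rfl))
  have hgP1 : g P < 1 := (hg hP1).trans_le (hg1 le_rfl)
  have hfP : f P ≤ P := by
    conv_rhs => rw [← hφP]
    exact hf.monotone hPg
  have hφ0 : ∀ i {x}, 0 ≤ x → 0 ≤ φ^[i] x := by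
    intro i x hx
    rw [← hst, ← wordMap_replicate]; exact wordMap_nonneg _ hx
  have hφi : ∀ i, Monotone φ^[i] := fun i => hφm.monotone.iterate i
  have hφiP : ∀ i, φ^[i] P = P := fun i => Function.iterate_fixed hφP i
  have hφinc : ∀ x, x ≤ P → x ≤ φ x := by
    intro x hx
    have h1 : φ x = φ P - (1 / 2) ^ (s ++ t).length * (P - x) := by
      rw [← hst, wordMap_eq _ x, wordMap_eq _ P]; ring
    have h2 : ((1 : ℝ) / 2) ^ (s ++ t).length ≤ 1 := pow_le_one₀ (by norm_num) (by norm_num)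
    rw [h1, hφP]
    nlinarith
  -- `φ^[n] 0` tends to `P`, so a large number `n` of repetitions of `st` keeps the tails above `b`
  obtain ⟨n, hn1, hn⟩ : ∃ n : ℕ, 1 ≤ n ∧ b < g (f (φ^[n] 0)) := by
    obtain ⟨n, hn⟩ := exists_pow_lt_of_lt_one (sub_pos.2 hb)
      (by norm_num : (1 / 2 : ℝ) < 1)
    refine ⟨n + 1, by omega, ?_⟩
    have h1 : P - φ^[n + 1] 0 ≤ (1 / 2) ^ n := by
      have h2 : φ^[n + 1] P = φ^[n + 1] 0 +
          (1 / 2) ^ (List.replicate (n + 1) (s ++ t)).flatten.length * P := by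
        rw [← hst, ← wordMap_replicate, ← wordMap_replicate, wordMap_eq _ P]
      rw [hφiP] at h2
      have hlen : n ≤ (List.replicate (n + 1) (s ++ t)).flatten.length := by
        rw [List.length_flatten, List.map_replicate, List.sum_replicate, smul_eq_mul]
        have : 1 ≤ (s ++ t).length := by rw [hs']; simp
        nlinarith
      have h3 : ((1 : ℝ) / 2) ^ (List.replicate (n + 1) (s ++ t)).flatten.length ≤ (1 / 2) ^ n :=
        pow_le_pow_of_le_one (by norm_num) (by norm_num) hlen
      have h4 : (0 : ℝ) < (1 / 2) ^ (List.replicate (n + 1) (s ++ t)).flatten.length := by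
        positivity
      nlinarith [hPm.1, hPm.2]
    have h2 : g (f P) - g (f (φ^[n + 1] 0)) ≤ P - φ^[n + 1] 0 := by
      have h3 := wordMap_eq (t ++ s) P
      have h4 := wordMap_eq (t ++ s) (φ^[n + 1] 0)
      rw [wordMap_append] at h3 h4
      have h5 : ((1 : ℝ) / 2) ^ (t ++ s).length ≤ 1 := pow_le_one₀ (by norm_num) (by norm_num)
      have h6 : φ^[n + 1] 0 ≤ P := by
        conv_rhs => rw [← hφiP (n + 1)]
        exact hφi _ hPm.1
      rw [← hfdef, ← hgdef] at h3 h4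
      rw [h3, h4]
      nlinarith
    linarith
  -- the two blocks and their limit set
  set A := s ++ (List.replicate n (s ++ t)).flatten with hA
  set B := s ++ (List.replicate (n + 1) (s ++ t)).flatten with hB
  have hlet : ∀ m, (s ++ (List.replicate m (s ++ t)).flatten) ≠ [] ∧
      ∀ c ∈ s ++ (List.replicate m (s ++ t)).flatten, c ≤ 1 := by
    intro m
    refine ⟨by rw [hs']; simp, fun c hc => ?_⟩
    rcases List.mem_append.1 hc with hc | hc
    · exact h.letters.1 c hc
    · obtain ⟨l, hl, hc⟩ := List.mem_flatten.1 hc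
      rw [List.eq_of_mem_replicate hl] at hc
      exact h.both.letters.1 c hc
  have hAm : wordMap A = fun x => f (φ^[n] x) := by
    funext x; rw [hA, wordMap_append, wordMap_replicate, hst]
  have hBm : wordMap B = fun x => f (φ^[n + 1] x) := by
    funext x; rw [hB, wordMap_append, wordMap_replicate, hst]
  set G := pairIfs A B (hlet n) (hlet (n + 1)) with hG
  have hGf : ∀ x, G.map false x = f (φ^[n] x) := fun x => by rw [hG, pairIfs_map_false, hAm]
  have hGt : ∀ x, G.map true x = f (φ^[n + 1] x) := fun x => by rw [hG, pairIfs_map_true, hBm]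
  have hstep : ∀ e, ∃ m, (m = n ∨ m = n + 1) ∧ G.code e = f (φ^[m] (G.code (shift 1 e))) := by
    intro e
    rw [G.code_eq e]
    cases e 0
    · exact ⟨n, Or.inl rfl, hGf _⟩
    · exact ⟨n + 1, Or.inr rfl, hGt _⟩
  have hKP : ∀ e, G.code e ≤ P := by
    have key : ∀ j e, G.code e ≤ P + (1 / 2) ^ j := by
      intro j
      induction j with
      | zero => intro e; rw [pow_zero]; linarith [(G.code_mem e).2, hPm.1]
      | succ j ih =>
        intro e
        have h1 := G.l_le (e 0)
        have h2 := G.l_pos (e 0)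
        have h3 : G.map (e 0) P ≤ P := by
          cases e 0
          · rw [hGf, hφiP]; exact hfP
          · rw [hGt, hφiP]; exact hfP
        have h4 : (0 : ℝ) < (1 / 2) ^ j := by positivity
        rw [G.code_eq, pow_succ]
        simp only [Ifs.map] at h3 ⊢
        nlinarith [ih (shift 1 e)]
    intro e
    refine le_of_forall_pos_le_add fun ε hε => ?_
    obtain ⟨j, hj⟩ := exists_pow_lt_of_lt_one hε (by norm_num : (1 / 2 : ℝ) < 1)
    linarith [key j e]
  -- the values of the tails that begin with a block `s` or `t`, and their bounds
  set U := f (φ^[n] 0) with hUdef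
  have hU0 : 0 ≤ U := hf01 (hφ0 n le_rfl)
  have hUf : U ≤ f 1 := by
    refine hf.monotone ?_
    rw [← hst, ← wordMap_replicate]
    refine wordMap_le_one (fun c hc => ?_) zero_le_one
    exact (hlet n).2 c (List.mem_append_right _ hc)
  have hUU : f U ≤ U := by
    refine hf.monotone ?_
    obtain ⟨n', rfl⟩ : ∃ n', n = n' + 1 := ⟨n - 1, by omega⟩
    rw [hUdef, Function.iterate_succ_apply']
    refine hf.monotone ?_
    refine (hf.monotone (hg1 ?_)).trans (hord.trans (hg.monotone (hφ0 n' le_rfl)))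
    refine le_trans ?_ hPm.2
    conv_rhs => rw [← hφiP n']
    exact hφi _ hPm.1
  have hUK : ∀ e, U ≤ G.code e := by
    intro e
    obtain ⟨m, hm, he⟩ := hstep e
    rw [he]
    refine hf.monotone ?_
    have h0 := (G.code_mem (shift 1 e)).1
    rcases hm with rfl | rfl
    · exact hφi _ h0
    · rw [Function.iterate_succ_apply]
      exact hφi _ (hf01 (hg01 h0))
  have hφK : ∀ i e, U ≤ φ^[i] (G.code e) ∧ φ^[i] (G.code e) ≤ P := by
    intro i e
    induction i with
    | zero => exact ⟨hUK e, hKP e⟩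
    | succ i ih =>
      rw [Function.iterate_succ_apply']
      refine ⟨ih.1.trans (hφinc _ ih.2), ?_⟩
      conv_rhs => rw [← hφP]
      exact hφm.monotone ih.2
  let ZZ : Set ℝ := {z | ∃ i e, z = φ^[i] (G.code e) ∨ z = g (φ^[i] (G.code e))}
  have hZ : ∀ z ∈ ZZ, U ≤ z ∧ z ≤ g P := by
    rintro z ⟨i, e, rfl | rfl⟩
    · exact ⟨(hφK i e).1, (hφK i e).2.trans hPg⟩
    · exact ⟨hUf.trans (hord.trans (hg.monotone (hU0.trans (hφK i e).1))),
        hg.monotone (hφK i e).2⟩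
  have hZs : ∀ z ∈ ZZ, ∃ z' ∈ ZZ, z = f z' ∨ z = g z' := by
    rintro z ⟨i, e, rfl | rfl⟩
    · cases i with
      | zero =>
        obtain ⟨m, -, he⟩ := hstep e
        exact ⟨_, ⟨m, _, Or.inl rfl⟩, Or.inl he⟩
      | succ i =>
        exact ⟨_, ⟨i, e, Or.inr rfl⟩, Or.inl (Function.iterate_succ_apply' _ _ _)⟩
    · exact ⟨_, ⟨i, e, Or.inl rfl⟩, Or.inr rfl⟩
  -- `S` contains the values of all tails, also of those that begin inside a block `s` or `t`
  let S : Set ℝ := {x | ∃ w z, (w <:+ s.tail ∨ w <:+ t.tail) ∧ z ∈ ZZ ∧ x = wordMap w z}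
  have hSb : ∀ x ∈ S, wordMap t.tail U ≤ x ∧ x ≤ wordMap s.tail (g P) := by
    rintro x ⟨w, z, hw, hz, rfl⟩
    exact h.suffix_bounds hU0 hgP1.le hUU (hZ z hz).1 (hZ z hz).2 (hg.monotone hPg) hUf
      (hg.monotone hPm.1) hw
  have hSs : ∀ x ∈ S, ∃ c : ℕ, ∃ x' ∈ S, c ≤ 1 ∧ x = ((c : ℝ) + x') / 2 := by
    rintro x ⟨w, z, hw, hz, rfl⟩
    cases w with
    | nil =>
      obtain ⟨z', hz', rfl | rfl⟩ := hZs z hz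
      · exact ⟨0, _, ⟨s.tail, z', Or.inl List.suffix_rfl, hz', rfl⟩, by omega, by
          rw [wordMap_nil, hfdef, hs']; rfl⟩
      · exact ⟨1, _, ⟨t.tail, z', Or.inr List.suffix_rfl, hz', rfl⟩, by omega, by
          rw [wordMap_nil, hgdef, ht']; rfl⟩
    | cons c w =>
      refine ⟨c, _, ⟨w, z, hw.imp (List.suffix_cons c w).trans (List.suffix_cons c w).trans, hz,
        rfl⟩, ?_, rfl⟩
      rcases hw with hw | hw
      · exact h.letters.1 c (List.mem_of_mem_tail (hw.subset List.mem_cons_self))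
      · exact h.letters.2 c (List.mem_of_mem_tail (hw.subset List.mem_cons_self))
  have hlo : 0 ≤ wordMap t.tail U := wordMap_nonneg _ hU0
  have hhi : wordMap s.tail (g P) < 1 :=
    (wordMap_strictMono _ hgP1).trans_le
      (wordMap_le_one (fun c hc => h.letters.1 c (List.mem_of_mem_tail hc)) le_rfl)
  have hfe : f (g P) = wordMap s.tail (g P) / 2 := by
    rw [hfdef, hs', wordMap_cons]; simp
  have hge : g U = (1 + wordMap t.tail U) / 2 := by
    rw [hgdef, ht', wordMap_cons]; simp
  have hST : ∀ x ∈ S, expandingMap 2 x ∈ S ∧ x ∉ Ioo a b := by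
    intro x hx
    obtain ⟨c, x', hx', hc, rfl⟩ := hSs x hx
    have hb' := hSb x' hx'
    constructor
    · have : expandingMap 2 (((c : ℝ) + x') / 2) = x' := by
        rw [expandingMap, Int.fract_eq_iff]
        refine ⟨by linarith, by linarith, c, ?_⟩
        push_cast; ring
      rwa [this]
    · obtain rfl | rfl : c = 0 ∨ c = 1 := by omega
      · intro h1
        have : f (g P) = P := hφP
        push_cast at h1
        linarith [h1.1]
      · intro h1
        push_cast at h1
        linarith [h1.2]
  have hSW : range G.code ⊆ survivorSet 2 a b := by
    rintro _ ⟨e, rfl⟩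
    have hx : G.code e ∈ S := ⟨[], _, Or.inl List.nil_suffix, ⟨0, e, Or.inl rfl⟩, rfl⟩
    have hit : ∀ j, (expandingMap 2)^[j] (G.code e) ∈ S := by
      intro j
      induction j with
      | zero => exact hx
      | succ j ih => rw [Function.iterate_succ_apply']; exact (hST _ ih).1
    exact ⟨⟨(G.code_mem e).1, (hKP e).trans_lt hP1⟩, fun j => (hST _ (hit j)).2⟩
  refine lt_of_lt_of_le ?_ (dimH_mono hSW)
  -- the second block continues with `st`, while the first is followed by `ss`
  have hgap : f P < f (g 0) := by
    refine hf ?_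
    calc P = f (g P) := hφP.symm
      _ < f 1 := hf hgP1
      _ ≤ g 0 := hord
  have hsp : 0 < (1 / 2 : ℝ) ^ A.length := by positivity
  refine G.dimH_range_code_pos (δ := (1 / 2) ^ A.length * (f (g 0) - f P))
    (mul_pos hsp (sub_pos.2 hgap)) fun e e' h0 h1 => ?_
  rw [abs_sub_comm]
  refine le_trans ?_ (le_abs_self _)
  rw [G.code_eq e, G.code_eq e', h0, h1, hGf, hGt, Function.iterate_succ_apply]
  have e1 : ∀ x, f (φ^[n] x) = wordMap A x := fun x => (congrFun hAm x).symm
  rw [e1, e1, wordMap_eq A (φ _), wordMap_eq A (G.code _), add_sub_add_left_eq_sub, ← mul_sub]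
  refine mul_le_mul_of_nonneg_left ?_ hsp.le
  have h2 : f (g 0) ≤ φ (G.code (shift 1 e')) :=
    hφm.monotone (G.code_mem _).1
  have h3 : G.code (shift 1 e) ≤ f P := by
    obtain ⟨m, -, he⟩ := hstep (shift 1 e)
    rw [he]
    exact hf.monotone (hφK m _).2
  linarith

lemma survivorDim_two_pos_iff {a b : ℝ} (ha0 : 0 ≤ a) (ha : a < 1 / 2) (hb : 1 / 2 < b) :
    0 < survivorDim 2 a b ↔ b < chi a := by
  rw [lt_chi_iff ha0 hb]
  constructor
  · intro hpos
    by_contra hno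
    exact hpos.ne' (NoWitness.survivorDim_eq_zero hno ha hb)
  · rintro ⟨s, t, h, x, hx, hxa, hbx⟩
    have hxe : x = altValue h := wordMap_fixed_unique h.both.ne_nil.1 hx (by
      rw [wordMap_append, wordMap_altValue])
    rw [wordMap_append] at hbx
    exact h.survivorDim_pos (hxe ▸ hxa) (hxe ▸ hbx)

end

end HoleDim

theorem theorem4p8 (k : ℕ) (hk : 3 ≤ k) (a b : ℝ) (ha0 : 0 ≤ a) (ha : a < 1 / (k : ℝ))
    (hb : ((k : ℝ) - 1) / (k : ℝ) < b) (hb1 : b ≤ 1) :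
    HoleDim.survivorDim k a b =
        ENNReal.ofReal (Real.logb (k : ℝ) 2) *
          HoleDim.survivorDim 2 (HoleDim.cantorFun k a) (HoleDim.cantorFun k b) ∧
      (0 < HoleDim.survivorDim k a b ↔
        HoleDim.cantorFun k b < HoleDim.chi (HoleDim.cantorFun k a)) := by
  have hk2 : 2 ≤ k := by omega
  have hmain := HoleDim.survivorDim_cantorFun hk2 ha0 ha hb hb1
  refine ⟨hmain, ?_⟩
  have hlog : 0 < Real.logb k 2 :=
    Real.logb_pos (by exact_mod_cast (by omega : 1 < k)) (by norm_num)
  rw [hmain, ← HoleDim.survivorDim_two_pos_iff (HoleDim.cantorFun_mem hk2 a).1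
    (HoleDim.cantorFun_lt_half hk2 ha0 ha) (HoleDim.half_lt_cantorFun hk2 hb hb1)]
  simp [pos_iff_ne_zero, hlog]
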